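/- **Setting.** Let $\mathbb X,\mathbb U,\mathcal M$ be finite sets ($\mathbb U,\mathcal M$ nonempty), $c:\mathbb X\times\mathbb U\to\mathbb R$ a cost function and $\beta\in(0,1)$. Consider $x_{t+1}=f(x_t,u_t,w_t)$, where $(w_t)$ is i.i.d. noise independent of $x_0\sim\pi_0\in\mathcal P(\mathbb X)$, and let $P(x'|x,u)$ be the probability that $f(x,u,w_0)=x'$. An admissible policy $\bar\gamma\in\Gamma_A$ consists of maps giving, at each time $t$, a channel symbol $q_t=\gamma^e_t(x_{[0,t]},q_{[0,t-1]})\in\mathcal M$ and a control $u_t=\gamma^c_t(q_{[0,t]},u_{[0,t-1]})\in\mathbb U$. Put $J_\beta(\pi_0,\bar\gamma)=\lim_{N\to\infty}E^{\bar\gamma}_{\pi_0}\big[\sum_{k=0}^{N-1}\beta^kc(x_k,u_k)\big]$ and $J_\beta(\pi_0)=\inf_{\bar\gamma\in\Gamma_A}J_\beta(\pi_0,\bar\gamma)$. **Controlled-predictor MDP.** Let $\mathcal Q$ be the set of all maps $Q:\mathbb X\to\mathcal M$ and $\mathcal H$ the set of all maps $\eta:\mathcal Q\times\mathcal M\to\mathbb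 U$. For $\pi\in\mathcal P(\mathbb X)$, $(Q,\eta)\in\mathcal Q\times\mathcal H$ and $q$ with $\pi(Q^{-1}(q))>0$ let $$F(\pi,Q,\eta,q)(x')=\frac1{\pi(Q^{-1}(q))}\sum_{x\in Q^{-1}(q)}P(x'|x,\eta(Q,q))\,\pi(x),$$ $$P(d\pi'|\pi,Q,\eta)=\sum_{q}\pi(Q^{-1}(q))\,\delta_{F(\pi,Q,\eta,q)}(d\pi'),\qquad \tilde c(\pi,Q,\eta)=\sum_x\pi(x)\,c\big(x,\eta(Q,Q(x))\big).$$ A map $\gamma:\mathcal P(\mathbb X)\to\mathcal Q\times\mathcal H$ is a stationary policy of this MDP. It defines an element of $\Gamma_A$ by $(Q_t,\eta_t)=\gamma(\pi_t)$, $q_t=Q_t(x_t)$, $u_t=\eta_t(Q_t,q_t)$, $\pi_{t+1}=F(\pi_t,Q_t,\eta_t,q_t)$. Its cost in the MDP is $\lim_{N\to\infty}E\big[\sum_{k=0}^{N-1}\beta^k\tilde c(\pi_k,Q_k,\eta_k)\big]$. **Quantization.** Let $d$ be a metric on $\mathcal P(\mathbb X)$ inducing its usual topology (for example the $L^1$ distance).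 For $n\ge1$ let $\mathcal P_n(\mathbb X)$ be the finite set of $\hat\pi\in\mathcal P(\mathbb X)$ all of whose entries lie in $\{0,\frac1n,\dots,\frac nn\}$, let $\rho_n:\mathcal P(\mathbb X)\to\mathcal P_n(\mathbb X)$ be a measurable nearest-neighbour map, $\rho_n(\pi)\in\arg\min_{\hat\pi\in\mathcal P_n(\mathbb X)}d(\pi,\hat\pi)$ (ties broken arbitrarily), with bins $B_{\hat\pi}=\rho_n^{-1}(\hat\pi)$, and let $\kappa_n$ be a Borel probability measure on $\mathcal P(\mathbb X)$ with $\kappa_n(B_{\hat\pi})>0$ for all $\hat\pi\in\mathcal P_n(\mathbb X)$ (for example, $\kappa_n=\kappa$ not depending on $n$). Let $\mathrm{MDP}_n$ be the finite MDP with state space $\mathcal P_n(\mathbb X)$, action space $\mathcal Q\times\mathcal H$, stage cost and transition probabilities $$c_n(\hat\pi,Q,\eta)=\int_{B_{\hat\pi}}\tilde c(\pi,Q,\eta)\frac{\kappa_n(d\pi)}{\kappa_n(B_{\hat\pi})},\qquad P_n(\hat\pi'|\hat\pi,Q,\eta)=\int_{B_{\hat\pi}}P(B_{\hat\pi'}|\pi,Q,\eta)\frac{\kappa_n(d\pi)}{\kappa_n(B_{\hat\pi})},$$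 and discount factor $\beta$. **Theorem.** For each $n\ge1$ let $\hat\gamma_n^*:\mathcal P_n(\mathbb X)\to\mathcal Q\times\mathcal H$ be an optimal stationary policy for the discounted cost of $\mathrm{MDP}_n$, and let $\tilde\gamma_n^*=\hat\gamma_n^*\circ\rho_n$ be its piecewise constant extension to $\mathcal P(\mathbb X)$. Then for every $\pi_0\in\mathcal P(\mathbb X)$ $$\lim_{n\to\infty}\big|J_\beta(\pi_0,\tilde\gamma_n^*)-J_\beta(\pi_0)\big|=0,$$ where $J_\beta(\pi_0,\tilde\gamma_n^*)$ may be taken either as the cost of $\tilde\gamma^*_n$ in the controlled-predictor MDP or as the cost, in the original system, of the admissible policy that it defines. -/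

import Mathlib

open MeasureTheory Filter Topology

noncomputable section

namespace PredictorQuantization

/-- The space of probability vectors on a finite set `X`, with its usual (weak) topology and
Borel sets. -/
abbrev Belief (X : Type*) [Fintype X] : Type _ := ↥(stdSimplex ℝ X)

/-- Quantizers `Q : X → M`. -/
abbrev Quantizer (X M : Type*) : Type _ := X → M

/-- Control rules `η : 𝒬 × M → U`. -/
abbrev ControlRule (X M U : Type*) : Type _ := Quantizer X M × M → U

/-- Actions `(Q, η)` of the controlled-predictor MDP. -/
abbrev Action (X M U : Type*) : Type _ := Quantizer X M × ControlRule X M U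

/-! ### The networked control system -/

/-- The source `x_{t+1} = f(x_t, u_t, w_t)`, with i.i.d. noise `w_t` of law `noise`. -/
structure Source (X U W : Type*) [MeasurableSpace W] where
  f : X → U → W → X
  noise : Measure W
  isProb : IsProbabilityMeasure noise
  measurableSet_f : ∀ x u x', MeasurableSet {w | f x u w = x'}

/-- Deterministic admissible joint coding-control policies: the encoder uses
`x_{[0,t]}, q_{[0,t-1]}` and the controller uses `q_{[0,t]}, u_{[0,t-1]}`. -/
structure AdmissiblePolicy (X U M : Type*) where
  enc : (t : ℕ) → (Fin (t + 1) → X) → (Fin t → M) → M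
  ctrl : (t : ℕ) → (Fin (t + 1) → M) → (Fin t → U) → U

section System

variable {X U M W : Type*} [MeasurableSpace W]

/-- `x_{[0,t]}`, `q_{[0,t-1]}` and `u_{[0,t-1]}`, as functions of `x_0` and of the noise. -/
def history (S : Source X U W) (γ : AdmissiblePolicy X U M) (x₀ : X) (w : ℕ → W) :
    (t : ℕ) → (Fin (t + 1) → X) × (Fin t → M) × (Fin t → U)
  | 0 => (fun _ => x₀, Fin.elim0, Fin.elim0)
  | t + 1 =>
    let h := history S γ x₀ w t
    let q : Fin (t + 1) → M := Fin.snoc (α := fun _ => M) h.2.1 (γ.enc t h.1 h.2.1)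
    let u : U := γ.ctrl t q h.2.2
    (Fin.snoc (α := fun _ => X) h.1 (S.f (h.1 (Fin.last t)) u (w t)),
      q, Fin.snoc (α := fun _ => U) h.2.2 u)

/-- The state `x_t`. -/
def stateAt (S : Source X U W) (γ : AdmissiblePolicy X U M) (x₀ : X) (w : ℕ → W) (t : ℕ) : X :=
  (history S γ x₀ w t).1 (Fin.last t)

/-- The control `u_t`. -/
def controlAt (S : Source X U W) (γ : AdmissiblePolicy X U M) (x₀ : X) (w : ℕ → W) (t : ℕ) : U :=
  (history S γ x₀ w (t + 1)).2.2 (Fin.last t)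

/-- The past channel symbols `q_{[0,t-1]}`. -/
def symbolsBefore (S : Source X U W) (γ : AdmissiblePolicy X U M) (x₀ : X) (w : ℕ → W) (t : ℕ) :
    Fin t → M :=
  (history S γ x₀ w t).2.1

/-- `P(x' | x, u)`. -/
def transProb (S : Source X U W) (x : X) (u : U) (x' : X) : ℝ :=
  S.noise.real {w | S.f x u w = x'}

lemma transProb_nonneg (S : Source X U W) (x : X) (u : U) (x' : X) :
    0 ≤ transProb S x u x' := measureReal_nonneg

variable [Fintype X]

/-- Expectation when `x_0` has law `π₀` and is independent of the i.i.d. noise. -/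
def expect (S : Source X U W) (π₀ : Belief X) (g : X → (ℕ → W) → ℝ) : ℝ :=
  haveI := S.isProb
  ∑ x₀, π₀.1 x₀ * ∫ w, g x₀ w ∂(Measure.infinitePi fun _ : ℕ => S.noise)

/-- The infinite-horizon discounted cost `lim_N E[∑_{k < N} β^k c(x_k, u_k)]` of an admissible
policy (the series converges absolutely, as `c` is bounded). -/
def systemCost (S : Source X U W) (c : X → U → ℝ) (β : ℝ) (π₀ : Belief X)
    (γ : AdmissiblePolicy X U M) : ℝ :=
  ∑' k : ℕ, β ^ k * expect S π₀ fun x₀ w => c (stateAt S γ x₀ w k) (controlAt S γ x₀ w k)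

/-- The optimal cost `J_β(π₀)` over all admissible policies with channel alphabet `M`. -/
def optimalCost (M : Type*) (S : Source X U W) (c : X → U → ℝ) (β : ℝ) (π₀ : Belief X) : ℝ :=
  ⨅ γ : AdmissiblePolicy X U M, systemCost S c β π₀ γ

/-! ### The controlled-predictor MDP -/

lemma sum_transProb (S : Source X U W) (x : X) (u : U) : ∑ x', transProb S x u x' = 1 := by
  classical
  have := S.isProb
  have h := measureReal_biUnion_finset (μ := S.noise) (s := (Finset.univ : Finset X))
    (f := fun x' => {w | S.f x u w = x'})
    (by
      intro a _ b _ hab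
      refine Set.disjoint_left.2 fun w hw hw' => hab ?_
      exact (show S.f x u w = a from hw).symm.trans hw')
    (fun x' _ => S.measurableSet_f x u x')
  have hU : (⋃ x' ∈ (Finset.univ : Finset X), {w | S.f x u w = x'}) = Set.univ := by
    ext w; simp
  rw [hU, probReal_univ] at h
  exact h.symm

open Classical in
/-- `π(Q⁻¹(q))`. -/
def cellMass (π : Belief X) (Q : Quantizer X M) (q : M) : ℝ :=
  ∑ x with Q x = q, π.1 x

open Classical in
/-- The predictor update
`F(π,Q,η,q)(x') = π(Q⁻¹(q))⁻¹ ∑_{x ∈ Q⁻¹(q)} P(x' | x, η(Q,q)) π(x)`.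
A symbol `q` of probability zero leaves the predictor unchanged (an arbitrary convention). -/
def update (S : Source X U W) (π : Belief X) (a : Action X M U) (q : M) : Belief X :=
  if h : cellMass π a.1 q = 0 then π else
    ⟨fun x' => (cellMass π a.1 q)⁻¹ *
        ∑ x with a.1 x = q, transProb S x (a.2 (a.1, q)) x' * π.1 x, by
      refine ⟨fun x' => ?_, ?_⟩
      · refine mul_nonneg (inv_nonneg.2 (Finset.sum_nonneg fun x _ => π.2.1 x))
          (Finset.sum_nonneg fun x _ => mul_nonneg (transProb_nonneg ..) (π.2.1 x))
      · rw [← Finset.mul_sum, Finset.sum_comm]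
        simp_rw [← Finset.sum_mul, sum_transProb, one_mul]
        exact inv_mul_cancel₀ h⟩

/-- The transition kernel `P(dπ' | π, Q, η)` of the predictor: `π' = F(π,Q,η,q)` with
probability `π(Q⁻¹(q))`. -/
def predictorKernel [Fintype M] (S : Source X U W) (π : Belief X) (a : Action X M U) :
    Measure (Belief X) :=
  ∑ q : M, ENNReal.ofReal (cellMass π a.1 q) • Measure.dirac (update S π a q)

/-- `c̃(π,Q,η)`, the expected stage cost when `x` has law `π`, `q = Q(x)` and `u = η(Q,q)`. -/
def predictorStageCost (c : X → U → ℝ) (π : Belief X) (a : Action X M U) : ℝ :=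
  ∑ x, π.1 x * c x (a.2 (a.1, a.1 x))

/-- The predictor `π_t` as a function of `q_{[0,t-1]}`, under the stationary
controlled-predictor-structured policy `(Q_t, η_t) = γ(π_t)`. -/
def predictorAt (S : Source X U W) (γ : Belief X → Action X M U) (π₀ : Belief X) :
    (t : ℕ) → (Fin t → M) → Belief X
  | 0, _ => π₀
  | t + 1, q =>
    let π := predictorAt S γ π₀ t (Fin.init (α := fun _ => M) q)
    update S π (γ π) (q (Fin.last t))

/-- The admissible policy defined by a stationary controlled-predictor-structured policy `γ`:
`(Q_t, η_t) = γ(π_t)`, `q_t = Q_t(x_t)`, `u_t = η_t(Q_t, q_t)`. -/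
def inducedPolicy (S : Source X U W) (γ : Belief X → Action X M U) (π₀ : Belief X) :
    AdmissiblePolicy X U M where
  enc t x q := (γ (predictorAt S γ π₀ t q)).1 (x (Fin.last t))
  ctrl t q _ :=
    let a := γ (predictorAt S γ π₀ t (Fin.init (α := fun _ => M) q))
    a.2 (a.1, q (Fin.last t))

/-- The discounted cost `lim_N E[∑_{k < N} β^k c̃(π_k, Q_k, η_k)]` of the controlled-predictor
MDP under the stationary policy `γ`. -/
def predictorCost (S : Source X U W) (c : X → U → ℝ) (β : ℝ) (π₀ : Belief X)
    (γ : Belief X → Action X M U) : ℝ :=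
  ∑' k : ℕ, β ^ k * expect S π₀ fun x₀ w =>
    let π := predictorAt S γ π₀ k (symbolsBefore S (inducedPolicy S γ π₀) x₀ w k)
    predictorStageCost c π (γ π)

end System

/-! ### Quantization of the predictor space -/

section Quantization

variable {X U M W : Type*} [MeasurableSpace W] [Fintype X]

/-- `d` is a metric on `𝒫(X)` that induces its topology. -/
structure IsCompatibleMetric (d : Belief X → Belief X → ℝ) : Prop where
  eq_zero_iff : ∀ π π', d π π' = 0 ↔ π = π'
  symm : ∀ π π', d π π' = d π' π
  triangle : ∀ π π' π'', d π π'' ≤ d π π' + d π' π''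
  mem_nhds_iff : ∀ (π : Belief X) (s : Set (Belief X)),
    s ∈ 𝓝 π ↔ ∃ ε > 0, ∀ π', d π π' < ε → π' ∈ s

/-- `𝒫_n(X)`: the probability vectors all of whose entries are of the form `k / n`,
`k = 0, …, n`. -/
abbrev Grid (X : Type*) [Fintype X] (n : ℕ+) : Type _ :=
  {π : Belief X // ∃ k : X → ℕ, (∀ x, k x ≤ n) ∧ ∀ x, π.1 x = (k x : ℝ) / (n : ℕ)}

instance (n : ℕ+) : Finite (Grid X n) := by
  classical
  choose k hk hk' using fun z : Grid X n => z.2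
  refine Finite.of_injective
    (fun z : Grid X n => fun x => (⟨k z x, Nat.lt_succ_of_le (hk z x)⟩ : Fin ((n : ℕ) + 1))) ?_
  intro z z' h
  apply Subtype.ext
  apply Subtype.ext
  funext x
  have hx : k z x = k z' x := congrArg Fin.val (congrFun h x)
  rw [hk' z x, hk' z' x, hx]

instance (n : ℕ+) : Fintype (Grid X n) := Fintype.ofFinite _

instance (n : ℕ+) : DecidableEq (Grid X n) := Classical.decEq _

/-- `ρ` is a measurable nearest-neighbour map onto the grid (ties broken arbitrarily). -/
structure IsNearestNeighbor (d : Belief X → Belief X → ℝ) {n : ℕ+} (ρ : Belief X → Grid X n) :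
    Prop where
  measurable : Measurable ρ
  le_dist : ∀ (π : Belief X) (z : Grid X n), d π (ρ π).1 ≤ d π z.1

/-- The bin of the grid point `z`. -/
def bin {n : ℕ+} (ρ : Belief X → Grid X n) (z : Grid X n) : Set (Belief X) := {π | ρ π = z}

/-- The stage cost `c_n(z,Q,η) = κ(B_z)⁻¹ ∫_{B_z} c̃(π,Q,η) κ(dπ)` of `MDP_n`. -/
def gridStageCost (c : X → U → ℝ) (κ : Measure (Belief X)) {n : ℕ+} (ρ : Belief X → Grid X n)
    (z : Grid X n) (a : Action X M U) : ℝ :=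
  (κ.real (bin ρ z))⁻¹ * ∫ π in bin ρ z, predictorStageCost c π a ∂κ

/-- The transition probability
`P_n(z' | z,Q,η) = κ(B_z)⁻¹ ∫_{B_z} P(B_{z'} | π,Q,η) κ(dπ)` of `MDP_n`. -/
def gridTrans [Fintype M] (S : Source X U W) (κ : Measure (Belief X)) {n : ℕ+}
    (ρ : Belief X → Grid X n) (z : Grid X n) (a : Action X M U) (z' : Grid X n) : ℝ :=
  (κ.real (bin ρ z))⁻¹ * ∫ π in bin ρ z, (predictorKernel S π a).real (bin ρ z') ∂κ

/-- The discounted cost of a stationary policy `γ` in `MDP_n`, from the initial state `z`: the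
expected cost at time `k` is obtained from the `k`-th power of the transition matrix. -/
def gridCost [Fintype M] (S : Source X U W) (c : X → U → ℝ) (β : ℝ) (κ : Measure (Belief X))
    {n : ℕ+} (ρ : Belief X → Grid X n) (γ : Grid X n → Action X M U) (z : Grid X n) : ℝ :=
  ∑' k : ℕ, β ^ k *
    ((Matrix.of fun z₁ z₂ => gridTrans S κ ρ z₁ (γ z₁) z₂) ^ k).mulVec
      (fun z₁ => gridStageCost c κ ρ z₁ (γ z₁)) z

/-- `γ` is an optimal (stationary) policy of `MDP_n`. -/
def IsOptimalGridPolicy [Fintype M] (S : Source X U W) (c : X → U → ℝ) (β : ℝ)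
    (κ : Measure (Belief X)) {n : ℕ+} (ρ : Belief X → Grid X n) (γ : Grid X n → Action X M U) :
    Prop :=
  ∀ (γ' : Grid X n → Action X M U) (z : Grid X n),
    gridCost S c β κ ρ γ z ≤ gridCost S c β κ ρ γ' z

/-- The piecewise constant extension of a policy of `MDP_n` to `𝒫(X)`. -/
def extendPolicy {n : ℕ+} (ρ : Belief X → Grid X n) (γ : Grid X n → Action X M U) :
    Belief X → Action X M U :=
  fun π => γ (ρ π)

end Quantization

end PredictorQuantization

end

open MeasureTheory Filter Topology

noncomputable section

set_option linter.unusedSectionVars false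

/-! Everything is compared with the `N`-stage value function `horizonValue`, defined on unnormalized
laws of the state. On nonnegative laws, consecutive horizons differ by at most `β ^ N * C` times the
mass, where `C` bounds `|c|`, so on beliefs `v = horizonValue M S c β N` almost solves the Bellman
equation of the predictor MDP.

Lower bound: given the past symbols and controls, an encoder that remembers old states acts as a
randomized quantizer of the current state. `v` is homogeneous and superadditive, hence concave, so
some deterministic quantizer does at least as well (`horizonValue_succ_le_jointValue`). Iteration
bounds `v π₀` by the `N`-stage cost of every admissible policy (`horizonValue_le_sum_stageExpect`),
hence by the optimal cost up to a geometric tail.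

Upper bound: the Bellman operator of the grid MDP averages that of the predictor MDP over a bin
(`gridBackup_eq`). Backups of `v` are continuous on a compact simplex and there are finitely many
actions, so their oscillation over bins tends to zero (`eventually_oscillation_le`). A contraction
estimate then puts the optimal grid cost uniformly close to `v` and makes the extended policy almost
greedy for `v` (`predictorBackup_le_of_isOptimal`); verification bounds its cost by `v π₀` plus a
small error (`systemCost_inducedPolicy_le`). The horizon `N` is fixed first, then `n` is taken
large.

The normalized update may be discontinuous where a cell loses its mass. Homogeneity removes the
difficulty: cell mass times the value at the updated belief is the value at the unnormalized flow,
which is continuous. -/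

namespace PredictorQuantization

/-! ### Finite-horizon value functions on unnormalized laws -/

section ValueIteration

variable {X U M W : Type*} [MeasurableSpace W] [Fintype X] [Fintype M]

/-- The unnormalized law of the next state on the event that the symbol `q` is sent, when
`a x q` is the mass of the current state `x` and the symbol `q`, and the control `u` is applied. -/
def jointFlow (S : Source X U W) (u : U) (q : M) (a : X → M → ℝ) : X → ℝ :=
  fun y => ∑ x, a x q * transProb S x u y

/-- One-stage cost plus discounted cost-to-go `v`, when the state and the symbol have the
unnormalized joint law `a` and the symbol `q` triggers the control `u q`. -/
def jointValue (S : Source X U W) (c : X → U → ℝ) (β : ℝ) (v : (X → ℝ) → ℝ) (u : M → U)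
    (a : X → M → ℝ) : ℝ :=
  (∑ x, ∑ q, a x q * c x (u q)) + β * ∑ q, v (jointFlow S (u q) q a)

open Classical in
/-- The joint law of the state and of the symbol `Q x`, when the state has law `m`. -/
def splitBy (Q : X → M) (m : X → ℝ) : X → M → ℝ := fun x q => if Q x = q then m x else 0

/-- The optimal cost over `N` stages, as a function of the unnormalized law of the state. -/
def horizonValue (M : Type*) [Fintype M] (S : Source X U W) (c : X → U → ℝ) (β : ℝ) :
    ℕ → (X → ℝ) → ℝ
  | 0, _ => 0
  | N + 1, m => ⨅ p : (X → M) × (M → U),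
      jointValue S c β (horizonValue M S c β N) p.2 (splitBy p.1 m)

variable (S : Source X U W) (c : X → U → ℝ) {β : ℝ}

lemma jointFlow_add (u : U) (q : M) (a b : X → M → ℝ) :
    jointFlow S u q (a + b) = jointFlow S u q a + jointFlow S u q b := by
  funext x'
  simp [jointFlow, add_mul, Finset.sum_add_distrib]

lemma jointFlow_smul (u : U) (q : M) (s : ℝ) (a : X → M → ℝ) :
    jointFlow S u q (s • a) = s • jointFlow S u q a := by
  funext x'
  simp [jointFlow, Finset.mul_sum, mul_assoc]

lemma jointFlow_nonneg (u : U) (q : M) {a : X → M → ℝ} (ha : ∀ x q, 0 ≤ a x q) (x' : X) :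
    0 ≤ jointFlow S u q a x' :=
  Finset.sum_nonneg fun x _ => mul_nonneg (ha x q) (transProb_nonneg S x u x')

lemma sum_jointFlow (u : U) (q : M) (a : X → M → ℝ) :
    ∑ x', jointFlow S u q a x' = ∑ x, a x q := by
  simp only [jointFlow]
  rw [Finset.sum_comm]
  simp_rw [← Finset.mul_sum, sum_transProb, mul_one]

lemma splitBy_add (Q : X → M) (m m' : X → ℝ) :
    splitBy Q (m + m') = splitBy Q m + splitBy Q m' := by
  classical
  funext x q
  simp only [splitBy, Pi.add_apply]
  split_ifs <;> simp

lemma splitBy_smul (Q : X → M) (s : ℝ) (m : X → ℝ) : splitBy Q (s • m) = s • splitBy Q m := by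
  classical
  funext x q
  simp [splitBy]

lemma splitBy_nonneg (Q : X → M) {m : X → ℝ} (hm : ∀ x, 0 ≤ m x) (x : X) (q : M) :
    0 ≤ splitBy Q m x q := by
  classical
  simp only [splitBy]
  split_ifs
  exacts [hm x, le_rfl]

lemma sum_splitBy_mul (Q : X → M) (m : X → ℝ) (x : X) (g : M → ℝ) :
    ∑ q, splitBy Q m x q * g q = m x * g (Q x) := by
  classical
  simp [splitBy]

lemma sum_splitBy (Q : X → M) (m : X → ℝ) (x : X) : ∑ q, splitBy Q m x q = m x := by
  simpa using sum_splitBy_mul Q m x fun _ => 1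

lemma continuous_splitBy (Q : X → M) : Continuous (splitBy Q : (X → ℝ) → X → M → ℝ) := by
  classical
  refine continuous_pi fun x => continuous_pi fun q => ?_
  by_cases h : Q x = q
  · simpa [splitBy, h] using continuous_apply x
  · simpa [splitBy, h] using continuous_const

lemma continuous_jointFlow (u : U) (q : M) :
    Continuous (jointFlow S u q : (X → M → ℝ) → X → ℝ) := by
  unfold jointFlow
  fun_prop

lemma continuous_jointValue {v : (X → ℝ) → ℝ} (hv : Continuous v) (u : M → U) :
    Continuous (jointValue S c β v u) := by
  have h (q : M) := hv.comp (continuous_jointFlow S (u q) q)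
  unfold jointValue
  refine Continuous.add (by fun_prop) (continuous_const.mul ?_)
  exact continuous_finsetSum _ fun q _ => h q

lemma jointValue_smul {v : (X → ℝ) → ℝ} {s : ℝ} (hv : ∀ m, v (s • m) = s * v m) (u : M → U)
    (a : X → M → ℝ) : jointValue S c β v u (s • a) = s * jointValue S c β v u a := by
  simp only [jointValue, jointFlow_smul, hv, Pi.smul_apply, smul_eq_mul, mul_add, Finset.mul_sum]
  congr 1
  · exact Finset.sum_congr rfl fun x _ => Finset.sum_congr rfl fun q _ => by ring
  · exact Finset.sum_congr rfl fun q _ => by ring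

lemma jointValue_add_le (hβ : 0 ≤ β) {v : (X → ℝ) → ℝ} (hv : ∀ m m', v m + v m' ≤ v (m + m'))
    (u : M → U) (a b : X → M → ℝ) :
    jointValue S c β v u a + jointValue S c β v u b ≤ jointValue S c β v u (a + b) := by
  simp only [jointValue, jointFlow_add, Pi.add_apply, add_mul, Finset.sum_add_distrib]
  have h := mul_le_mul_of_nonneg_left (Finset.sum_le_sum fun q (_ : q ∈ Finset.univ) =>
    hv (jointFlow S (u q) q a) (jointFlow S (u q) q b)) hβ
  rw [Finset.sum_add_distrib, mul_add] at h
  linarith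

/-- Homogeneity is what allows conditional laws to be replaced by unnormalized ones throughout. -/
lemma horizonValue_smul (N : ℕ) {s : ℝ} (hs : 0 ≤ s) (m : X → ℝ) :
    horizonValue M S c β N (s • m) = s * horizonValue M S c β N m := by
  induction N generalizing m with
  | zero => simp [horizonValue]
  | succ N ih =>
    simp only [horizonValue, Real.mul_iInf_of_nonneg hs, splitBy_smul]
    exact iInf_congr fun p => jointValue_smul S c ih p.2 _

lemma horizonValue_zero_measure (N : ℕ) : horizonValue M S c β N (0 : X → ℝ) = 0 := by
  simpa using horizonValue_smul (M := M) S c (β := β) N le_rfl (0 : X → ℝ)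

variable [Finite U]

lemma horizonValue_succ_le (N : ℕ) (m : X → ℝ) (Q : X → M) (u : M → U) :
    horizonValue M S c β (N + 1) m ≤
      jointValue S c β (horizonValue M S c β N) u (splitBy Q m) :=
  ciInf_le (f := fun p : (X → M) × (M → U) =>
    jointValue S c β (horizonValue M S c β N) p.2 (splitBy p.1 m))
    (Set.finite_range _).bddBelow (Q, u)

variable [Nonempty U] [Nonempty M]

lemma exists_horizonValue_succ_eq (N : ℕ) (m : X → ℝ) : ∃ (Q : X → M) (u : M → U),
    jointValue S c β (horizonValue M S c β N) u (splitBy Q m) =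
      horizonValue M S c β (N + 1) m := by
  obtain ⟨p, hp⟩ := exists_eq_ciInf_of_finite (f := fun p : (X → M) × (M → U) =>
    jointValue S c β (horizonValue M S c β N) p.2 (splitBy p.1 m))
  exact ⟨p.1, p.2, hp⟩

/-- A pair optimal for the sum is also a candidate for each summand: knowing which summand occurred
can only lower the cost. -/
lemma horizonValue_add_le (hβ : 0 ≤ β) (N : ℕ) (m m' : X → ℝ) :
    horizonValue M S c β N m + horizonValue M S c β N m' ≤ horizonValue M S c β N (m + m') := by
  induction N generalizing m m' with
  | zero => simp [horizonValue]
  | succ N ih =>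
    obtain ⟨Q, u, h⟩ := exists_horizonValue_succ_eq (M := M) S c (β := β) N (m + m')
    rw [← h, splitBy_add]
    exact (add_le_add (horizonValue_succ_le ..) (horizonValue_succ_le ..)).trans
      (jointValue_add_le S c hβ ih u _ _)

lemma sum_horizonValue_le (hβ : 0 ≤ β) (N : ℕ) {ι : Type*} (s : Finset ι) (m : ι → X → ℝ) :
    ∑ i ∈ s, horizonValue M S c β N (m i) ≤ horizonValue M S c β N (∑ i ∈ s, m i) := by
  classical
  induction s using Finset.induction_on with
  | empty => simp [horizonValue_zero_measure]
  | insert i s hi ih =>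
    rw [Finset.sum_insert hi, Finset.sum_insert hi]
    exact (add_le_add_right ih _).trans (horizonValue_add_le S c hβ N _ _)

lemma continuous_horizonValue (N : ℕ) : Continuous (horizonValue M S c β N) := by
  induction N with
  | zero => exact continuous_const
  | succ N ih =>
    have := Fintype.ofFinite ((X → M) × (M → U))
    have h : horizonValue M S c β (N + 1) = fun m =>
        Finset.univ.inf' Finset.univ_nonempty fun p : (X → M) × (M → U) =>
          jointValue S c β (horizonValue M S c β N) p.2 (splitBy p.1 m) := by
      funext m
      rw [Finset.inf'_univ_eq_ciInf, horizonValue]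
    rw [h]
    exact Continuous.finset_inf'_apply _ fun p _ =>
      (continuous_jointValue S c ih p.2).comp (continuous_splitBy p.1)

/-- Randomized quantizers do not improve on deterministic ones. -/
lemma horizonValue_succ_le_jointValue (hβ : 0 ≤ β) (N : ℕ) (u : M → U) {a : X → M → ℝ}
    (ha : ∀ x q, 0 ≤ a x q) :
    horizonValue M S c β (N + 1) (fun x => ∑ q, a x q) ≤
      jointValue S c β (horizonValue M S c β N) u a := by
  classical
  set m : X → ℝ := fun x => ∑ q, a x q with hm
  obtain ⟨q₀⟩ := ‹Nonempty M›
  -- The conditional law of the symbol given the state; at a state of zero mass any vertex of the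
  -- simplex serves.
  let K : X → M → ℝ := fun x => if m x = 0 then Pi.single q₀ 1 else fun q => a x q / m x
  have hK : K ∈ Set.univ.pi fun _ : X => stdSimplex ℝ M := by
    intro x _
    by_cases hx : m x = 0
    · simpa [K, hx] using single_mem_stdSimplex ℝ q₀
    · simp only [K, hx, if_false]
      refine ⟨fun q => div_nonneg (ha x q) (Finset.sum_nonneg fun q _ => ha x q), ?_⟩
      rw [← Finset.sum_div]
      exact div_self hx
  have hKa : (fun x q => m x * K x q) = a := by
    funext x q
    by_cases hx : m x = 0
    · have := (Finset.sum_eq_zero_iff_of_nonneg fun q _ => ha x q).1 hx q (Finset.mem_univ q)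
      simp [hx, this]
    · simp only [K, hx, if_false]
      field_simp
  have hconc : ConcaveOn ℝ Set.univ fun K : X → M → ℝ =>
      jointValue S c β (horizonValue M S c β N) u fun x q => m x * K x q := by
    refine ⟨convex_univ, fun K₁ _ K₂ _ s t hs ht _ => ?_⟩
    have h := jointValue_add_le S c hβ (horizonValue_add_le (M := M) S c hβ N) u
      (s • fun x q => m x * K₁ x q) (t • fun x q => m x * K₂ x q)
    rw [jointValue_smul S c fun m => horizonValue_smul S c N hs m,
      jointValue_smul S c fun m => horizonValue_smul S c N ht m] at h
    refine h.trans_eq (congrArg _ ?_)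
    funext x q
    simp only [Pi.add_apply, Pi.smul_apply, smul_eq_mul]
    ring
  -- The product of simplices is the convex hull of its vertices, which are the deterministic
  -- quantizers; a concave function is no larger at some vertex than at `K`.
  simp_rw [← convexHull_rangle_single_eq_stdSimplex ℝ M] at hK
  rw [← convexHull_pi] at hK
  obtain ⟨K', hK', hle⟩ := hconc.exists_le_of_mem_convexHull (Set.subset_univ _) hK
  choose Q hQ using fun x => hK' x (Set.mem_univ x)
  have hsplit : (fun x q => m x * K' x q) = splitBy Q m := by
    funext x q
    rw [← hQ x]
    simp [splitBy, Pi.single_apply, eq_comm]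
  simp only [hKa, hsplit] at hle
  exact (horizonValue_succ_le S c N m Q u).trans hle

/-- The flow preserves mass, so an error proportional to the mass contracts by the factor `β`. -/
lemma jointValue_mono (hβ : 0 ≤ β) {v v' : (X → ℝ) → ℝ} {δ : ℝ} {a : X → M → ℝ}
    (ha : ∀ x q, 0 ≤ a x q) (hv : ∀ m : X → ℝ, (∀ x, 0 ≤ m x) → v m ≤ v' m + δ * ∑ x, m x)
    (u : M → U) :
    jointValue S c β v u a ≤ jointValue S c β v' u a + β * δ * ∑ x, ∑ q, a x q := by
  have h := mul_le_mul_of_nonneg_left (Finset.sum_le_sum fun q (_ : q ∈ Finset.univ) =>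
    hv _ (jointFlow_nonneg S (u q) q ha)) hβ
  rw [Finset.sum_add_distrib, mul_add, ← Finset.mul_sum] at h
  simp_rw [sum_jointFlow] at h
  rw [Finset.sum_comm] at h
  simp only [jointValue]
  linarith

lemma abs_horizonValue_one_le {C : ℝ} (hC : ∀ x u, |c x u| ≤ C) {m : X → ℝ}
    (hm : ∀ x, 0 ≤ m x) : |horizonValue M S c β 1 m| ≤ C * ∑ x, m x := by
  obtain ⟨Q, u, h⟩ := exists_horizonValue_succ_eq (M := M) S c (β := β) 0 m
  rw [← h]
  simp only [jointValue, horizonValue, sum_splitBy_mul, Finset.sum_const_zero, mul_zero, add_zero]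
  rw [Finset.mul_sum]
  refine (Finset.abs_sum_le_sum_abs _ _).trans (Finset.sum_le_sum fun x _ => ?_)
  rw [abs_mul, abs_of_nonneg (hm x), mul_comm]
  exact mul_le_mul_of_nonneg_right (hC _ _) (hm x)

/-- Value iteration contracts: a minimizer for one horizon is tried in the other, once in each
direction. -/
lemma abs_horizonValue_succ_sub_le (hβ : 0 ≤ β) {C : ℝ} (hC : ∀ x u, |c x u| ≤ C) (N : ℕ)
    {m : X → ℝ} (hm : ∀ x, 0 ≤ m x) :
    |horizonValue M S c β (N + 1) m - horizonValue M S c β N m| ≤ β ^ N * C * ∑ x, m x := by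
  induction N generalizing m with
  | zero => simpa [horizonValue] using abs_horizonValue_one_le (M := M) S c (β := β) hC hm
  | succ N ih =>
    have hsum (Q : X → M) : ∑ x, ∑ q, splitBy Q m x q = ∑ x, m x := by simp [sum_splitBy]
    rw [abs_le]
    constructor
    · obtain ⟨Q, u, h⟩ := exists_horizonValue_succ_eq (M := M) S c (β := β) (N + 1) m
      have h₁ := horizonValue_succ_le S c (β := β) N m Q u
      have h₂ := jointValue_mono S c hβ (splitBy_nonneg Q hm)
        (v := horizonValue M S c β N) (v' := horizonValue M S c β (N + 1)) (δ := β ^ N * C)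
        (fun m hm => by linarith [(abs_le.1 (ih hm)).1]) u
      rw [hsum] at h₂
      rw [← h, pow_succ']
      linarith
    · obtain ⟨Q, u, h⟩ := exists_horizonValue_succ_eq (M := M) S c (β := β) N m
      have h₁ := horizonValue_succ_le S c (β := β) (N + 1) m Q u
      have h₂ := jointValue_mono S c hβ (splitBy_nonneg Q hm)
        (v := horizonValue M S c β (N + 1)) (v' := horizonValue M S c β N) (δ := β ^ N * C)
        (fun m hm => by linarith [(abs_le.1 (ih hm)).2]) u
      rw [hsum] at h₂
      rw [← h, pow_succ']
      linarith

end ValueIteration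

/-! ### Independence of the current noise from the past history -/

section HistoryLaw

variable {X U M W : Type*}

/-- The symbol `q_t` sent after the history `h`. -/
def symbolOf (γ : AdmissiblePolicy X U M) {t : ℕ}
    (h : (Fin (t + 1) → X) × (Fin t → M) × (Fin t → U)) : M :=
  γ.enc t h.1 h.2.1

/-- The control `u_t` applied when the symbol `q` follows the past symbols and controls `i`. -/
def controlOf (γ : AdmissiblePolicy X U M) {t : ℕ} (i : (Fin t → M) × (Fin t → U)) (q : M) : U :=
  γ.ctrl t (Fin.snoc (α := fun _ => M) i.1 q) i.2

/-- The symbols and controls up to time `t`, when the symbol `q` follows those before. -/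
def nextInfo (γ : AdmissiblePolicy X U M) {t : ℕ} (i : (Fin t → M) × (Fin t → U)) (q : M) :
    (Fin (t + 1) → M) × (Fin (t + 1) → U) :=
  (Fin.snoc (α := fun _ => M) i.1 q, Fin.snoc (α := fun _ => U) i.2 (controlOf γ i q))

/-- The history at time `t + 1`, when the state `x'` follows the history `h`. -/
def nextHistory (γ : AdmissiblePolicy X U M) {t : ℕ}
    (h : (Fin (t + 1) → X) × (Fin t → M) × (Fin t → U)) (x' : X) :
    (Fin (t + 1 + 1) → X) × (Fin (t + 1) → M) × (Fin (t + 1) → U) :=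
  (Fin.snoc (α := fun _ => X) h.1 x', nextInfo γ h.2 (symbolOf γ h))

variable [MeasurableSpace W]

lemma history_succ (S : Source X U W) (γ : AdmissiblePolicy X U M) (x₀ : X) (w : ℕ → W) (t : ℕ) :
    history S γ x₀ w (t + 1) = nextHistory γ (history S γ x₀ w t)
      (S.f ((history S γ x₀ w t).1 (Fin.last t))
        (controlOf γ (history S γ x₀ w t).2 (symbolOf γ (history S γ x₀ w t))) (w t)) := rfl

lemma controlAt_eq (S : Source X U W) (γ : AdmissiblePolicy X U M) (x₀ : X) (w : ℕ → W) (t : ℕ) :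
    controlAt S γ x₀ w t =
      controlOf γ (history S γ x₀ w t).2 (symbolOf γ (history S γ x₀ w t)) := by
  simp [controlAt, history_succ, nextHistory, nextInfo]

/-- The law of the noise process. -/
def noiseLaw (S : Source X U W) : Measure (ℕ → W) :=
  haveI := S.isProb
  Measure.infinitePi fun _ : ℕ => S.noise

instance (S : Source X U W) : IsProbabilityMeasure (noiseLaw S) := by
  have := S.isProb
  unfold noiseLaw
  infer_instance

/-- The events that depend on the noise before time `t` only. -/
@[reducible]
def pastNoise (W : Type*) [MeasurableSpace W] (t : ℕ) : MeasurableSpace (ℕ → W) :=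
  ⨆ i ∈ Set.Iio t, MeasurableSpace.comap (fun w : ℕ → W => w i) inferInstance

lemma pastNoise_mono {s t : ℕ} (h : s ≤ t) : pastNoise W s ≤ pastNoise W t :=
  biSup_mono fun _ hi => lt_of_lt_of_le hi h

lemma pastNoise_le (t : ℕ) : pastNoise W t ≤ MeasurableSpace.pi :=
  iSup₂_le fun i _ => (measurable_pi_apply i).comap_le

lemma indep_pastNoise (S : Source X U W) (t : ℕ) :
    ProbabilityTheory.Indep (pastNoise W t)
      (MeasurableSpace.comap (fun w : ℕ → W => w t) inferInstance) (noiseLaw S) := by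
  have := S.isProb
  have h := ProbabilityTheory.iIndepFun_infinitePi (P := fun _ : ℕ => S.noise)
    (X := fun _ w => w) fun _ => measurable_id
  have h' := ProbabilityTheory.indep_iSup_of_disjoint (S := Set.Iio t) (T := {t})
    (fun i => (measurable_pi_apply i).comap_le) h.iIndep (by simp)
  rw [iSup_singleton] at h'
  exact h'

lemma noiseLaw_eval_real (S : Source X U W) (t : ℕ) {A : Set W} (hA : MeasurableSet A) :
    (noiseLaw S).real {w | w t ∈ A} = S.noise.real A := by
  have := S.isProb
  have h := Measure.infinitePi_map_eval (fun _ : ℕ => S.noise) t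
  rw [measureReal_def, measureReal_def]
  conv_rhs => rw [← h, Measure.map_apply (measurable_pi_apply t) hA]
  rfl

variable [Finite X] [Finite U] [Finite M]

/-- The history at time `t` uses only the noise strictly before `t`. The finite spaces carry no
σ-algebra, so measurability is expressed through level sets. -/
lemma measurableSet_history_eq (S : Source X U W) (γ : AdmissiblePolicy X U M) (x₀ : X) (t : ℕ)
    (h : (Fin (t + 1) → X) × (Fin t → M) × (Fin t → U)) :
    MeasurableSet[pastNoise W t] {w | history S γ x₀ w t = h} := by
  induction t with
  | zero =>
    simp only [history]
    exact MeasurableSet.const _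
  | succ t ih =>
    have hset : {w | history S γ x₀ w (t + 1) = h} =
        ⋃ (g : (Fin (t + 1) → X) × (Fin t → M) × (Fin t → U)) (x' : X)
          (_ : nextHistory γ g x' = h), {w | history S γ x₀ w t = g} ∩
            {w | S.f (g.1 (Fin.last t)) (controlOf γ g.2 (symbolOf γ g)) (w t) = x'} := by
      ext w
      simp only [Set.mem_ofPred_eq, Set.mem_iUnion, Set.mem_inter_iff, history_succ]
      constructor
      · intro hw
        exact ⟨_, _, hw, rfl, rfl⟩
      · rintro ⟨g, x', hg, rfl, rfl⟩
        exact hg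
    rw [hset]
    refine MeasurableSet.iUnion fun g => MeasurableSet.iUnion fun x' => MeasurableSet.iUnion
      fun _ => MeasurableSet.inter (pastNoise_mono t.le_succ _ (ih g)) ?_
    have hle : MeasurableSpace.comap (fun w : ℕ → W => w t) inferInstance ≤ pastNoise W (t + 1) :=
      le_iSup₂_of_le t (Set.mem_Iio.2 t.lt_succ_self) le_rfl
    exact hle _ ⟨_, S.measurableSet_f _ _ _, rfl⟩

lemma noiseLaw_history_inter (S : Source X U W) (γ : AdmissiblePolicy X U M) (x₀ : X) (t : ℕ)
    (h : (Fin (t + 1) → X) × (Fin t → M) × (Fin t → U)) (x : X) (u : U) (x' : X) :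
    (noiseLaw S).real {w | history S γ x₀ w t = h ∧ S.f x u (w t) = x'} =
      (noiseLaw S).real {w | history S γ x₀ w t = h} * transProb S x u x' := by
  have h₁ := (ProbabilityTheory.Indep_iff _ _ _).1 (indep_pastNoise S t) _
    {w | w t ∈ {w | S.f x u w = x'}} (measurableSet_history_eq S γ x₀ t h)
    ⟨_, S.measurableSet_f x u x', rfl⟩
  have h₂ := congrArg ENNReal.toReal h₁
  rw [ENNReal.toReal_mul] at h₂
  rw [transProb, ← noiseLaw_eval_real S t (S.measurableSet_f x u x')]
  exact h₂

end HistoryLaw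

/-! ### Expectations as finite sums over histories -/

section Expectation

variable {X U M W : Type*} [MeasurableSpace W] [Fintype X] [Fintype U] [Fintype M]

/-- The probability that the history at time `t` is `h`. -/
def historyProb (S : Source X U W) (γ : AdmissiblePolicy X U M) (π₀ : Belief X) (t : ℕ)
    (h : (Fin (t + 1) → X) × (Fin t → M) × (Fin t → U)) : ℝ :=
  ∑ x₀, π₀.1 x₀ * (noiseLaw S).real {w | history S γ x₀ w t = h}

/-- The expectation of a function of the history at time `t`. -/
def historyExpect (S : Source X U W) (γ : AdmissiblePolicy X U M) (π₀ : Belief X) (t : ℕ)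
    (g : (Fin (t + 1) → X) × (Fin t → M) × (Fin t → U) → ℝ) : ℝ :=
  ∑ h, historyProb S γ π₀ t h * g h

variable (S : Source X U W) (γ : AdmissiblePolicy X U M) (π₀ : Belief X)

lemma historyProb_nonneg (t : ℕ) (h : (Fin (t + 1) → X) × (Fin t → M) × (Fin t → U)) :
    0 ≤ historyProb S γ π₀ t h :=
  Finset.sum_nonneg fun x _ => mul_nonneg (π₀.2.1 x) measureReal_nonneg

/-- A finite-valued random variable has a finite sum as its expectation. -/
lemma integral_finite_valued {Ω T : Type*} [MeasurableSpace Ω] [Fintype T] (μ : Measure Ω)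
    [IsFiniteMeasure μ] (Y : Ω → T) (hY : ∀ y, MeasurableSet {ω | Y ω = y}) (g : T → ℝ) :
    ∫ ω, g (Y ω) ∂μ = ∑ y, μ.real {ω | Y ω = y} * g y := by
  classical
  have h : (fun ω => g (Y ω)) =
      fun ω => ∑ y, ({ω | Y ω = y} : Set Ω).indicator (fun _ => g y) ω := by
    funext ω
    simp [Set.indicator_apply]
  rw [h, integral_finsetSum]
  · refine Finset.sum_congr rfl fun y _ => ?_
    rw [integral_indicator_const _ (hY y), smul_eq_mul]
  · exact fun y _ => (integrable_const _).indicator (hY y)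

lemma expect_history (t : ℕ) (g : (Fin (t + 1) → X) × (Fin t → M) × (Fin t → U) → ℝ) :
    expect S π₀ (fun x₀ w => g (history S γ x₀ w t)) = historyExpect S γ π₀ t g := by
  have h (x₀ : X) := integral_finite_valued (noiseLaw S) (fun w => history S γ x₀ w t)
    (fun h => pastNoise_le t _ (measurableSet_history_eq S γ x₀ t h)) g
  simp only [historyExpect, historyProb, Finset.sum_mul]
  rw [Finset.sum_comm]
  refine Finset.sum_congr rfl fun x₀ _ => ?_
  simp_rw [mul_assoc]
  rw [← Finset.mul_sum, ← h x₀]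
  rfl

lemma historyExpect_zero (g : (Fin (0 + 1) → X) × (Fin 0 → M) × (Fin 0 → U) → ℝ) :
    historyExpect S γ π₀ 0 g = ∑ x₀, π₀.1 x₀ * g (fun _ => x₀, Fin.elim0, Fin.elim0) := by
  rw [← expect_history]
  simp only [expect, history]
  have := S.isProb
  simp

/-- The Markov property: given the history at time `t`, the next state has the law
`P(· | x_t, u_t)`. -/
lemma historyExpect_succ (t : ℕ)
    (g : (Fin (t + 1 + 1) → X) × (Fin (t + 1) → M) × (Fin (t + 1) → U) → ℝ) :
    historyExpect S γ π₀ (t + 1) g = historyExpect S γ π₀ t fun h =>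
      ∑ x', transProb S (h.1 (Fin.last t)) (controlOf γ h.2 (symbolOf γ h)) x' *
        g (nextHistory γ h x') := by
  rw [← expect_history, historyExpect]
  simp only [expect, historyProb, Finset.sum_mul]
  rw [Finset.sum_comm]
  refine Finset.sum_congr rfl fun x₀ _ => ?_
  simp_rw [mul_assoc]
  rw [← Finset.mul_sum]
  congr 1
  -- The old history paired with the new state determines the new history, and independence
  -- factorizes the law of this pair.
  let Y : (ℕ → W) → ((Fin (t + 1) → X) × (Fin t → M) × (Fin t → U)) × X := fun w =>
    (history S γ x₀ w t, S.f ((history S γ x₀ w t).1 (Fin.last t))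
      (controlOf γ (history S γ x₀ w t).2 (symbolOf γ (history S γ x₀ w t))) (w t))
  have hY (h : (Fin (t + 1) → X) × (Fin t → M) × (Fin t → U)) (x' : X) : {w | Y w = (h, x')} =
      {w | history S γ x₀ w t = h ∧
        S.f (h.1 (Fin.last t)) (controlOf γ h.2 (symbolOf γ h)) (w t) = x'} := by
    ext w
    simp only [Y, Set.mem_ofPred_eq, Prod.mk.injEq]
    constructor
    · rintro ⟨rfl, h'⟩
      exact ⟨rfl, h'⟩
    · rintro ⟨rfl, h'⟩
      exact ⟨rfl, h'⟩
  have hmeas (y : ((Fin (t + 1) → X) × (Fin t → M) × (Fin t → U)) × X) :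
      MeasurableSet {w | Y w = y} := by
    rw [hY y.1 y.2]
    have h₂ : MeasurableSet {w : ℕ → W | S.f (y.1.1 (Fin.last t))
        (controlOf γ y.1.2 (symbolOf γ y.1)) (w t) = y.2} :=
      MeasurableSet.preimage (S.measurableSet_f _ _ y.2) (measurable_pi_apply t)
    exact (pastNoise_le t _ (measurableSet_history_eq S γ x₀ t y.1)).inter h₂
  have h := integral_finite_valued (noiseLaw S) Y hmeas fun y => g (nextHistory γ y.1 y.2)
  rw [Fintype.sum_prod_type] at h
  refine Eq.trans h (Finset.sum_congr rfl fun h _ => ?_)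
  rw [Finset.mul_sum]
  refine Finset.sum_congr rfl fun x' _ => ?_
  rw [hY, noiseLaw_history_inter, mul_assoc]

lemma historyExpect_mono (t : ℕ) {g g' : (Fin (t + 1) → X) × (Fin t → M) × (Fin t → U) → ℝ}
    (h : ∀ i, g i ≤ g' i) : historyExpect S γ π₀ t g ≤ historyExpect S γ π₀ t g' :=
  Finset.sum_le_sum fun i _ => mul_le_mul_of_nonneg_left (h i) (historyProb_nonneg S γ π₀ t i)

lemma historyExpect_add (t : ℕ) (g g' : (Fin (t + 1) → X) × (Fin t → M) × (Fin t → U) → ℝ) :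
    historyExpect S γ π₀ t (fun h => g h + g' h) =
      historyExpect S γ π₀ t g + historyExpect S γ π₀ t g' := by
  simp only [historyExpect, mul_add, Finset.sum_add_distrib]

lemma historyExpect_const_mul (t : ℕ) (b : ℝ)
    (g : (Fin (t + 1) → X) × (Fin t → M) × (Fin t → U) → ℝ) :
    historyExpect S γ π₀ t (fun h => b * g h) = b * historyExpect S γ π₀ t g := by
  simp only [historyExpect, Finset.mul_sum]
  exact Finset.sum_congr rfl fun _ _ => by ring

lemma historyExpect_const (t : ℕ) (b : ℝ) : historyExpect S γ π₀ t (fun _ => b) = b := by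
  rw [← expect_history S γ π₀ t fun _ => b]
  have := S.isProb
  simp only [expect, integral_const, probReal_univ, one_smul]
  rw [← Finset.sum_mul, π₀.2.2, one_mul]

lemma abs_historyExpect_le (t : ℕ) {b : ℝ}
    {g : (Fin (t + 1) → X) × (Fin t → M) × (Fin t → U) → ℝ} (h : ∀ i, |g i| ≤ b) :
    |historyExpect S γ π₀ t g| ≤ b := by
  have h₁ := historyExpect_mono S γ π₀ t fun i => (abs_le.1 (h i)).1
  have h₂ := historyExpect_mono S γ π₀ t fun i => (abs_le.1 (h i)).2
  rw [historyExpect_const] at h₁ h₂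
  exact abs_le.2 ⟨h₁, h₂⟩

end Expectation

/-! ### Estimates for discounted series -/

section DiscountedSums

lemma summable_discounted {β : ℝ} (hβ₀ : 0 ≤ β) (hβ₁ : β < 1) {e : ℕ → ℝ} {C : ℝ}
    (he : ∀ k, |e k| ≤ C) : Summable fun k => β ^ k * e k := by
  refine Summable.of_norm_bounded ((summable_geometric_of_lt_one hβ₀ hβ₁).mul_right C) fun k => ?_
  rw [Real.norm_eq_abs, abs_mul, abs_of_nonneg (pow_nonneg hβ₀ k)]
  exact mul_le_mul_of_nonneg_left (he k) (pow_nonneg hβ₀ k)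

lemma abs_discounted_le {β : ℝ} (hβ₀ : 0 ≤ β) (hβ₁ : β < 1) {e : ℕ → ℝ} {C : ℝ}
    (he : ∀ k, |e k| ≤ C) : |∑' k, β ^ k * e k| ≤ C / (1 - β) := by
  rw [div_eq_inv_mul, ← Real.norm_eq_abs]
  refine tsum_of_norm_bounded ((hasSum_geometric_of_lt_one hβ₀ hβ₁).mul_right C) fun k => ?_
  rw [Real.norm_eq_abs, abs_mul, abs_of_nonneg (pow_nonneg hβ₀ k)]
  exact mul_le_mul_of_nonneg_left (he k) (pow_nonneg hβ₀ k)

lemma sum_range_le_discounted {β : ℝ} (hβ₀ : 0 ≤ β) (hβ₁ : β < 1) {e : ℕ → ℝ} {C : ℝ}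
    (he : ∀ k, |e k| ≤ C) (N : ℕ) :
    ∑ k ∈ Finset.range N, β ^ k * e k - β ^ N * C / (1 - β) ≤ ∑' k, β ^ k * e k := by
  rw [← (summable_discounted hβ₀ hβ₁ he).sum_add_tsum_nat_add N]
  have h := (abs_le.1 (abs_discounted_le hβ₀ hβ₁ fun k => he (k + N))).1
  have h' := mul_le_mul_of_nonneg_left h (pow_nonneg hβ₀ N)
  rw [← tsum_mul_left] at h'
  have h'' : ∑' k, β ^ N * (β ^ k * e (k + N)) = ∑' k, β ^ (k + N) * e (k + N) :=
    tsum_congr fun k => by rw [pow_add]; ring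
  rw [h''] at h'
  rw [mul_div_assoc]
  linarith

/-- If `v` is a supersolution of the dynamic programming inequality up to `Δ`, the discounted
cost is at most `v 0 + Δ / (1 - β)`. -/
lemma discounted_le_of_supersolution {β : ℝ} (hβ₀ : 0 ≤ β) (hβ₁ : β < 1) {e v : ℕ → ℝ}
    {C B Δ : ℝ} (he : ∀ k, |e k| ≤ C) (hv : ∀ k, |v k| ≤ B)
    (h : ∀ k, e k + β * v (k + 1) ≤ v k + Δ) :
    ∑' k, β ^ k * e k ≤ v 0 + Δ / (1 - β) := by
  -- The inequalities `h k`, weighted by `β ^ k`, telescope; boundedness of `v` kills the last term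
  -- in the limit.
  have hK (K : ℕ) : ∑ k ∈ Finset.range K, β ^ k * e k + β ^ K * v K ≤
      v 0 + Δ * ∑ k ∈ Finset.range K, β ^ k := by
    induction K with
    | zero => simp
    | succ K ih =>
      rw [Finset.sum_range_succ, Finset.sum_range_succ]
      have := mul_le_mul_of_nonneg_left (h K) (pow_nonneg hβ₀ K)
      rw [pow_succ]
      linarith
  have hz : Tendsto (fun K => β ^ K * v K) atTop (𝓝 0) :=
    (summable_discounted hβ₀ hβ₁ hv).tendsto_atTop_zero
  have h₁ := (summable_discounted hβ₀ hβ₁ he).hasSum.tendsto_sum_nat.add hz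
  have h₂ := ((hasSum_geometric_of_lt_one hβ₀ hβ₁).tendsto_sum_nat.const_mul Δ).const_add (v 0)
  rw [add_zero] at h₁
  rw [div_eq_mul_inv]
  exact le_of_tendsto_of_tendsto' h₁ h₂ hK

end DiscountedSums

/-! ### Lower bound over all admissible policies -/

section LowerBound

variable {X U M W : Type*} [MeasurableSpace W] [Fintype X] [Fintype U] [Fintype M]
  (S : Source X U W) (γ : AdmissiblePolicy X U M) (π₀ : Belief X)

lemma historyExpect_sum (t : ℕ) {ι : Type*} (s : Finset ι)
    (g : ι → (Fin (t + 1) → X) × (Fin t → M) × (Fin t → U) → ℝ) :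
    historyExpect S γ π₀ t (fun h => ∑ j ∈ s, g j h) = ∑ j ∈ s, historyExpect S γ π₀ t (g j) := by
  simp only [historyExpect, Finset.mul_sum]
  exact Finset.sum_comm

open Classical in
/-- The probability that `x_t = x` and that the past symbols and controls are `i`. -/
def infoMass (t : ℕ) (i : (Fin t → M) × (Fin t → U)) (x : X) : ℝ :=
  historyExpect S γ π₀ t fun h => if h.2 = i ∧ h.1 (Fin.last t) = x then 1 else 0

open Classical in
/-- The probability that `x_t = x`, `q_t = q` and that the past symbols and controls are `i`. -/
def infoSymbolMass (t : ℕ) (i : (Fin t → M) × (Fin t → U)) (x : X) (q : M) : ℝ :=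
  historyExpect S γ π₀ t fun h =>
    if h.2 = i ∧ h.1 (Fin.last t) = x ∧ symbolOf γ h = q then 1 else 0

lemma infoSymbolMass_nonneg (t : ℕ) (i : (Fin t → M) × (Fin t → U)) (x : X) (q : M) :
    0 ≤ infoSymbolMass S γ π₀ t i x q := by
  classical
  refine Finset.sum_nonneg fun h _ => mul_nonneg (historyProb_nonneg S γ π₀ t h) ?_
  dsimp only
  split_ifs <;> norm_num

lemma historyExpect_eq_sum_infoSymbolMass (t : ℕ)
    (φ : (Fin t → M) × (Fin t → U) → X → M → ℝ) :
    historyExpect S γ π₀ t (fun h => φ h.2 (h.1 (Fin.last t)) (symbolOf γ h)) =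
      ∑ i, ∑ x, ∑ q, infoSymbolMass S γ π₀ t i x q * φ i x q := by
  classical
  have h : (fun h : (Fin (t + 1) → X) × (Fin t → M) × (Fin t → U) =>
      φ h.2 (h.1 (Fin.last t)) (symbolOf γ h)) = fun h => ∑ i, ∑ x, ∑ q, φ i x q *
        if h.2 = i ∧ h.1 (Fin.last t) = x ∧ symbolOf γ h = q then 1 else 0 := by
    funext h
    simp [ite_and]
  rw [h]
  simp only [historyExpect_sum, historyExpect_const_mul]
  refine Finset.sum_congr rfl fun i _ => Finset.sum_congr rfl fun x _ =>
    Finset.sum_congr rfl fun q _ => mul_comm _ _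

lemma sum_infoSymbolMass (t : ℕ) (i : (Fin t → M) × (Fin t → U)) (x : X) :
    ∑ q, infoSymbolMass S γ π₀ t i x q = infoMass S γ π₀ t i x := by
  classical
  simp only [infoSymbolMass, infoMass]
  rw [← historyExpect_sum]
  congr 1
  funext h
  simp [ite_and]

-- The control depends only on the past information and the new symbol, so older states enter only
-- through the joint law of the current state and symbol.
open Classical in
lemma infoMass_succ (t : ℕ) (i' : (Fin (t + 1) → M) × (Fin (t + 1) → U)) :
    infoMass S γ π₀ (t + 1) i' =
      ∑ p : ((Fin t → M) × (Fin t → U)) × M with nextInfo γ p.1 p.2 = i',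
        jointFlow S (controlOf γ p.1 p.2) p.2 (infoSymbolMass S γ π₀ t p.1) := by
  funext x'
  have h := historyExpect_eq_sum_infoSymbolMass S γ π₀ t fun i x q =>
    if nextInfo γ i q = i' then transProb S x (controlOf γ i q) x' else 0
  rw [infoMass, historyExpect_succ]
  refine Eq.trans (congrArg (historyExpect S γ π₀ t) (funext fun g => ?_)) (h.trans ?_)
  · simp [nextHistory, ite_and]
  rw [Finset.sum_apply, Finset.sum_filter]
  refine Eq.trans (Finset.sum_congr rfl fun i _ => ?_) (Fintype.sum_prod_type _).symm
  rw [Finset.sum_comm]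
  refine Finset.sum_congr rfl fun q _ => ?_
  split_ifs <;> simp [jointFlow]

variable (c : X → U → ℝ) {β : ℝ}

/-- The expected cost at time `t`. -/
def stageExpect (t : ℕ) : ℝ :=
  historyExpect S γ π₀ t fun h => c (h.1 (Fin.last t)) (controlOf γ h.2 (symbolOf γ h))

lemma expect_stage (t : ℕ) :
    expect S π₀ (fun x₀ w => c (stateAt S γ x₀ w t) (controlAt S γ x₀ w t)) =
      stageExpect S γ π₀ c t := by
  rw [stageExpect, ← expect_history]
  simp only [controlAt_eq, stateAt]

lemma abs_stageExpect_le {C : ℝ} (hC : ∀ x u, |c x u| ≤ C) (t : ℕ) :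
    |stageExpect S γ π₀ c t| ≤ C :=
  abs_historyExpect_le S γ π₀ t fun _ => hC _ _

variable [Nonempty U] [Nonempty M]

/-- One dynamic programming step. Concavity replaces the effective randomized quantizer by a
deterministic one, separately for each past information `i`; superadditivity then collects the flows
leading to the same new information, so injectivity of `nextInfo` is not needed. -/
lemma sum_horizonValue_infoMass_le_step (hβ : 0 ≤ β) (N t : ℕ) :
    ∑ i, horizonValue M S c β (N + 1) (infoMass S γ π₀ t i) ≤
      stageExpect S γ π₀ c t +
        β * ∑ i, horizonValue M S c β N (infoMass S γ π₀ (t + 1) i) := by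
  classical
  have h₁ : ∑ i, horizonValue M S c β (N + 1) (infoMass S γ π₀ t i) ≤
      ∑ i, jointValue S c β (horizonValue M S c β N) (controlOf γ i)
        (infoSymbolMass S γ π₀ t i) := by
    refine Finset.sum_le_sum fun i _ => ?_
    rw [show infoMass S γ π₀ t i = fun x => ∑ q, infoSymbolMass S γ π₀ t i x q from
      funext fun x => (sum_infoSymbolMass S γ π₀ t i x).symm]
    exact horizonValue_succ_le_jointValue S c hβ N _ (infoSymbolMass_nonneg S γ π₀ t i)
  have h₂ : stageExpect S γ π₀ c t =
      ∑ i, ∑ x, ∑ q, infoSymbolMass S γ π₀ t i x q * c x (controlOf γ i q) :=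
    historyExpect_eq_sum_infoSymbolMass S γ π₀ t fun i x q => c x (controlOf γ i q)
  have h₃ : ∑ i, ∑ q, horizonValue M S c β N
        (jointFlow S (controlOf γ i q) q (infoSymbolMass S γ π₀ t i)) ≤
      ∑ i, horizonValue M S c β N (infoMass S γ π₀ (t + 1) i) := by
    rw [← Fintype.sum_prod_type', ← Finset.sum_fiberwise Finset.univ
      fun p : ((Fin t → M) × (Fin t → U)) × M => nextInfo γ p.1 p.2]
    refine Finset.sum_le_sum fun i' _ => ?_
    rw [infoMass_succ]
    exact sum_horizonValue_le S c hβ N _ fun p : ((Fin t → M) × (Fin t → U)) × M =>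
      jointFlow S (controlOf γ p.1 p.2) p.2 (infoSymbolMass S γ π₀ t p.1)
  simp only [jointValue, Finset.sum_add_distrib, ← Finset.mul_sum] at h₁
  rw [h₂]
  linarith [mul_le_mul_of_nonneg_left h₃ hβ]

lemma sum_horizonValue_infoMass_le (hβ : 0 ≤ β) (N t : ℕ) :
    ∑ i, horizonValue M S c β N (infoMass S γ π₀ t i) ≤
      ∑ k ∈ Finset.range N, β ^ k * stageExpect S γ π₀ c (t + k) := by
  induction N generalizing t with
  | zero => simp [horizonValue]
  | succ N ih =>
    refine (sum_horizonValue_infoMass_le_step S γ π₀ c hβ N t).trans ?_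
    rw [Finset.sum_range_succ', add_comm]
    refine add_le_add ?_ (by simp)
    refine (mul_le_mul_of_nonneg_left (ih (t + 1)) hβ).trans_eq ?_
    rw [Finset.mul_sum]
    refine Finset.sum_congr rfl fun k _ => ?_
    rw [show t + 1 + k = t + (k + 1) by ring, pow_succ']
    ring

/-- No admissible policy has a smaller cost over `N` stages than the optimal one of the
controlled-predictor problem. -/
lemma horizonValue_le_sum_stageExpect (hβ : 0 ≤ β) (N : ℕ) :
    horizonValue M S c β N π₀.1 ≤ ∑ k ∈ Finset.range N, β ^ k * stageExpect S γ π₀ c k := by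
  have h := sum_horizonValue_infoMass_le S γ π₀ c hβ N 0
  simp only [zero_add] at h
  refine le_trans (le_of_eq ?_) h
  -- At time zero there is a single, empty information vector, and its mass function is `π₀`.
  rw [Fintype.sum_subsingleton _ (Fin.elim0, Fin.elim0)]
  congr 1
  funext x
  rw [infoMass, historyExpect_zero]
  rw [Finset.sum_eq_single x]
  · rw [if_pos ⟨Subsingleton.elim (α := (Fin 0 → M) × (Fin 0 → U)) _ _, rfl⟩, mul_one]
  · intro y _ hy
    rw [if_neg fun h => hy h.2, mul_zero]
  · exact fun h => absurd (Finset.mem_univ x) h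

lemma horizonValue_sub_le_systemCost (hβ₀ : 0 ≤ β) (hβ₁ : β < 1) {C : ℝ}
    (hC : ∀ x u, |c x u| ≤ C) (N : ℕ) :
    horizonValue M S c β N π₀.1 - β ^ N * C / (1 - β) ≤ systemCost S c β π₀ γ := by
  simp only [systemCost, expect_stage]
  have h₁ := horizonValue_le_sum_stageExpect S γ π₀ c hβ₀ N
  have h₂ := sum_range_le_discounted hβ₀ hβ₁ (abs_stageExpect_le S γ π₀ c hC) N
  linarith

end LowerBound

/-! ### The predictor update and its Bellman backup -/

section Update

variable {X U M W : Type*} [MeasurableSpace W] [Fintype X] [Fintype M]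

lemma cellMass_nonneg (π : Belief X) (Q : X → M) (q : M) : 0 ≤ cellMass π Q q :=
  Finset.sum_nonneg fun x _ => π.2.1 x

lemma cellMass_eq_sum_splitBy (π : Belief X) (Q : X → M) (q : M) :
    cellMass π Q q = ∑ x, splitBy Q π.1 x q := by
  classical
  simp only [cellMass, splitBy, Finset.sum_filter]

/-- Multiplying by the cell mass undoes the normalization. On a null cell both sides vanish, so the
convention in `update` is immaterial. -/
lemma cellMass_smul_update (S : Source X U W) (π : Belief X) (a : Action X M U) (q : M) :
    cellMass π a.1 q • (update S π a q).1 =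
      jointFlow S (a.2 (a.1, q)) q (splitBy a.1 π.1) := by
  classical
  funext x'
  by_cases h : cellMass π a.1 q = 0
  · have h' := h
    rw [cellMass_eq_sum_splitBy,
      Finset.sum_eq_zero_iff_of_nonneg fun x _ => splitBy_nonneg a.1 π.2.1 x q] at h'
    rw [h, zero_smul]
    exact (Finset.sum_eq_zero fun x hx => by rw [h' x hx, zero_mul]).symm
  · simp only [update, h, dif_neg, not_false_eq_true, Pi.smul_apply, smul_eq_mul]
    rw [mul_inv_cancel_left₀ h, jointFlow, Finset.sum_filter]
    refine Finset.sum_congr rfl fun x _ => ?_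
    simp only [splitBy]
    split_ifs
    · exact mul_comm _ _
    · rw [zero_mul]

lemma sum_cellMass_mul (π : Belief X) (Q : X → M) (g : M → ℝ) :
    ∑ q, cellMass π Q q * g q = ∑ x, π.1 x * g (Q x) := by
  simp_rw [← sum_splitBy_mul, cellMass_eq_sum_splitBy, Finset.sum_mul]
  exact Finset.sum_comm

lemma sum_cellMass (π : Belief X) (Q : X → M) : ∑ q, cellMass π Q q = 1 := by
  simpa [π.2.2] using sum_cellMass_mul π Q fun _ => 1

/-- The stage cost plus the expected discounted value of `g` at the next predictor. -/
def predictorBackup (S : Source X U W) (c : X → U → ℝ) (β : ℝ) (g : Belief X → ℝ) (π : Belief X)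
    (a : Action X M U) : ℝ :=
  predictorStageCost c π a + β * ∑ q, cellMass π a.1 q * g (update S π a q)

lemma predictorBackup_mono (S : Source X U W) (c : X → U → ℝ) {β : ℝ} (hβ : 0 ≤ β)
    {g g' : Belief X → ℝ} {D : ℝ} (h : ∀ π, g π ≤ g' π + D) (π : Belief X) (a : Action X M U) :
    predictorBackup S c β g π a ≤ predictorBackup S c β g' π a + β * D := by
  have h₁ : ∑ q, cellMass π a.1 q * g (update S π a q) ≤
      ∑ q, cellMass π a.1 q * (g' (update S π a q) + D) :=
    Finset.sum_le_sum fun q _ => mul_le_mul_of_nonneg_left (h _) (cellMass_nonneg π a.1 q)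
  simp only [mul_add, Finset.sum_add_distrib, ← Finset.sum_mul, sum_cellMass, one_mul] at h₁
  have h₂ := mul_le_mul_of_nonneg_left h₁ hβ
  simp only [predictorBackup]
  linarith

lemma jointValue_splitBy (S : Source X U W) (c : X → U → ℝ) (β : ℝ) (N : ℕ) (π : Belief X)
    (a : Action X M U) :
    jointValue S c β (horizonValue M S c β N) (fun q => a.2 (a.1, q)) (splitBy a.1 π.1) =
      predictorBackup S c β (fun π => horizonValue M S c β N π.1) π a := by
  simp only [jointValue, predictorBackup, predictorStageCost, sum_splitBy_mul]
  congr 2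
  refine Finset.sum_congr rfl fun q _ => ?_
  rw [← cellMass_smul_update, horizonValue_smul S c N (cellMass_nonneg π a.1 q)]

/-- Continuity is read off from the unnormalized form `jointValue`, which avoids any continuity of
`update`. -/
lemma continuous_predictorBackup [Finite U] [Nonempty U] [Nonempty M] (S : Source X U W)
    (c : X → U → ℝ) (β : ℝ) (N : ℕ) (a : Action X M U) :
    Continuous fun π =>
      predictorBackup S c β (fun π => horizonValue M S c β N π.1) π a := by
  simp_rw [← jointValue_splitBy]
  exact (continuous_jointValue S c (continuous_horizonValue S c N) _).comp
    ((continuous_splitBy a.1).comp continuous_subtype_val)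

end Update

/-! ### Stationary predictor policies run in the original system -/

section InducedPolicy

variable {X U M W : Type*} [MeasurableSpace W] [Fintype X] [Fintype U] [Fintype M]
  (S : Source X U W) (γ : Belief X → Action X M U) (π₀ : Belief X)

lemma predictorAt_snoc (t : ℕ) (qs : Fin t → M) (q : M) :
    predictorAt S γ π₀ (t + 1) (Fin.snoc (α := fun _ => M) qs q) =
      update S (predictorAt S γ π₀ t qs) (γ (predictorAt S γ π₀ t qs)) q := by
  simp [predictorAt]

lemma symbolOf_inducedPolicy {t : ℕ} (h : (Fin (t + 1) → X) × (Fin t → M) × (Fin t → U)) :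
    symbolOf (inducedPolicy S γ π₀) h =
      (γ (predictorAt S γ π₀ t h.2.1)).1 (h.1 (Fin.last t)) := rfl

lemma controlOf_inducedPolicy {t : ℕ} (i : (Fin t → M) × (Fin t → U)) (q : M) :
    controlOf (inducedPolicy S γ π₀) i q =
      (γ (predictorAt S γ π₀ t i.1)).2 ((γ (predictorAt S γ π₀ t i.1)).1, q) := by
  simp [controlOf, inducedPolicy]

/-- Bayes' rule, integrated: grouping the states by quantizer cell turns the true transition into
the predictor update. -/
lemma sum_transProb_eq_sum_update (π : Belief X) (a : Action X M U) (g : M → X → ℝ) :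
    ∑ x, π.1 x * ∑ x', transProb S x (a.2 (a.1, a.1 x)) x' * g (a.1 x) x' =
      ∑ x, π.1 x * ∑ x', (update S π a (a.1 x)).1 x' * g (a.1 x) x' := by
  rw [← sum_cellMass_mul π a.1 fun q => ∑ x', (update S π a q).1 x' * g q x']
  have h (q : M) (x' : X) : cellMass π a.1 q * ((update S π a q).1 x' * g q x') =
      ∑ x, splitBy a.1 π.1 x q * (transProb S x (a.2 (a.1, q)) x' * g q x') := by
    have := congrFun (cellMass_smul_update S π a q) x'
    rw [Pi.smul_apply, smul_eq_mul, jointFlow] at this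
    rw [← mul_assoc, this, Finset.sum_mul]
    exact Finset.sum_congr rfl fun x _ => mul_assoc _ _ _
  simp_rw [Finset.mul_sum, h]
  refine Eq.symm ((Finset.sum_congr rfl fun q _ => Finset.sum_comm).trans
    (Finset.sum_comm.trans (Finset.sum_congr rfl fun x _ => ?_)))
  simp_rw [← Finset.mul_sum]
  exact (sum_splitBy_mul a.1 π.1 x
    fun q => ∑ y, transProb S x (a.2 (a.1, q)) y * g q y)

/-- Under an induced policy, `π_t` is the conditional law of `x_t` given the past symbols. -/
lemma historyExpect_predictor (t : ℕ) (φ : (Fin t → M) → X → ℝ) :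
    historyExpect S (inducedPolicy S γ π₀) π₀ t (fun h => φ h.2.1 (h.1 (Fin.last t))) =
      historyExpect S (inducedPolicy S γ π₀) π₀ t
        fun h => ∑ x, (predictorAt S γ π₀ t h.2.1).1 x * φ h.2.1 x := by
  induction t with
  | zero =>
    simp only [historyExpect_zero, predictorAt]
    rw [← Finset.sum_mul, π₀.2.2, one_mul]
  | succ t ih =>
    -- The induction hypothesis is applied to the integrands of both sides, written as functions of
    -- the past symbols and current state; Bayes' rule then identifies the two averages.
    have hl := ih fun qs x =>
      ∑ x', transProb S x ((γ (predictorAt S γ π₀ t qs)).2 ((γ (predictorAt S γ π₀ t qs)).1,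
        (γ (predictorAt S γ π₀ t qs)).1 x)) x' *
          φ (Fin.snoc (α := fun _ => M) qs ((γ (predictorAt S γ π₀ t qs)).1 x)) x'
    have hr := ih fun qs x =>
      ∑ x', (update S (predictorAt S γ π₀ t qs) (γ (predictorAt S γ π₀ t qs))
        ((γ (predictorAt S γ π₀ t qs)).1 x)).1 x' *
          φ (Fin.snoc (α := fun _ => M) qs ((γ (predictorAt S γ π₀ t qs)).1 x)) x'
    rw [historyExpect_succ, historyExpect_succ]
    simp only [nextHistory, nextInfo, controlOf_inducedPolicy, symbolOf_inducedPolicy,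
      Fin.snoc_last, predictorAt_snoc, ← Finset.sum_mul, sum_transProb, one_mul]
    rw [hl, hr]
    congr 1
    funext h
    exact sum_transProb_eq_sum_update S _ _
      fun q x' => φ (Fin.snoc (α := fun _ => M) h.2.1 q) x'

variable (c : X → U → ℝ) {β : ℝ}

lemma stageExpect_inducedPolicy (t : ℕ) :
    stageExpect S (inducedPolicy S γ π₀) π₀ c t =
      historyExpect S (inducedPolicy S γ π₀) π₀ t fun h =>
        predictorStageCost c (predictorAt S γ π₀ t h.2.1) (γ (predictorAt S γ π₀ t h.2.1)) := by
  simp only [stageExpect, controlOf_inducedPolicy, symbolOf_inducedPolicy]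
  exact historyExpect_predictor S γ π₀ t fun qs x =>
    c x ((γ (predictorAt S γ π₀ t qs)).2 ((γ (predictorAt S γ π₀ t qs)).1,
      (γ (predictorAt S γ π₀ t qs)).1 x))

/-- The cost of a stationary policy is the same in the original system and in the
controlled-predictor MDP. -/
lemma predictorCost_eq_systemCost :
    predictorCost S c β π₀ γ = systemCost S c β π₀ (inducedPolicy S γ π₀) := by
  simp only [predictorCost, systemCost]
  refine tsum_congr fun k => ?_
  rw [expect_stage, stageExpect_inducedPolicy, ← expect_history]
  rfl

lemma historyExpect_predictor_succ (t : ℕ) (g : Belief X → ℝ) :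
    historyExpect S (inducedPolicy S γ π₀) π₀ (t + 1)
        (fun h => g (predictorAt S γ π₀ (t + 1) h.2.1)) =
      historyExpect S (inducedPolicy S γ π₀) π₀ t fun h =>
        ∑ q, cellMass (predictorAt S γ π₀ t h.2.1) (γ (predictorAt S γ π₀ t h.2.1)).1 q *
          g (update S (predictorAt S γ π₀ t h.2.1) (γ (predictorAt S γ π₀ t h.2.1)) q) := by
  rw [historyExpect_succ]
  simp only [nextHistory, nextInfo, symbolOf_inducedPolicy, predictorAt_snoc, ← Finset.sum_mul,
    sum_transProb, one_mul, sum_cellMass_mul]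
  exact historyExpect_predictor S γ π₀ t fun qs x =>
    g (update S (predictorAt S γ π₀ t qs) (γ (predictorAt S γ π₀ t qs))
      ((γ (predictorAt S γ π₀ t qs)).1 x))

/-- Verification: along the closed loop the expected values of `g` at the predictors form a
supersolution up to `Δ`. -/
lemma systemCost_inducedPolicy_le (hβ₀ : 0 ≤ β) (hβ₁ : β < 1) {C B Δ : ℝ}
    (hC : ∀ x u, |c x u| ≤ C) {g : Belief X → ℝ} (hB : ∀ π, |g π| ≤ B)
    (hg : ∀ π, predictorBackup S c β g π (γ π) ≤ g π + Δ) :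
    systemCost S c β π₀ (inducedPolicy S γ π₀) ≤ g π₀ + Δ / (1 - β) := by
  simp only [systemCost, expect_stage]
  have h₀ : historyExpect S (inducedPolicy S γ π₀) π₀ 0
      (fun h => g (predictorAt S γ π₀ 0 h.2.1)) = g π₀ :=
    historyExpect_const S _ π₀ 0 (g π₀)
  rw [← h₀]
  refine discounted_le_of_supersolution hβ₀ hβ₁ (B := B)
    (v := fun t => historyExpect S (inducedPolicy S γ π₀) π₀ t
      fun h => g (predictorAt S γ π₀ t h.2.1))
    (abs_stageExpect_le S _ π₀ c hC) (fun t => abs_historyExpect_le S _ π₀ t fun _ => hB _) ?_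
  intro t
  rw [historyExpect_predictor_succ, stageExpect_inducedPolicy, ← historyExpect_const_mul,
    ← historyExpect_add, ← historyExpect_const S (inducedPolicy S γ π₀) π₀ t Δ,
    ← historyExpect_add]
  exact historyExpect_mono S _ π₀ t fun h => hg _

end InducedPolicy

/-! ### Density of the grids and uniform smallness of the bins -/

section GridDensity

variable {X : Type*} [Fintype X]

/-- All coordinates but one are rounded down to multiples of `1 / n`; the distinguished coordinate
`x₀` absorbs the remaining mass. -/
lemma exists_grid_tendsto (π : Belief X) :
    ∃ z : (n : ℕ+) → Grid X n, Tendsto (fun n => (z n).1) atTop (𝓝 π) := by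
  classical
  have hne : Nonempty X := by
    by_contra h
    rw [not_nonempty_iff] at h
    have := π.2.2
    simp at this
  obtain ⟨x₀⟩ := hne
  let s : Finset X := Finset.univ.erase x₀
  have hsum (f : X → ℝ) : ∑ x, f x = ∑ x ∈ s, f x + f x₀ :=
    (Finset.sum_erase_add _ _ (Finset.mem_univ x₀)).symm
  let k : ℕ+ → X → ℕ := fun n x =>
    if x = x₀ then n - ∑ y ∈ s, ⌊π.1 y * (n : ℕ)⌋₊ else ⌊π.1 x * (n : ℕ)⌋₊
  have hn (n : ℕ+) : (0 : ℝ) < (n : ℕ) := by exact_mod_cast n.pos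
  -- This makes the truncated subtraction in `k` a genuine one.
  have hle (n : ℕ+) : ∑ y ∈ s, ⌊π.1 y * (n : ℕ)⌋₊ ≤ n := by
    have h : ((∑ y ∈ s, ⌊π.1 y * (n : ℕ)⌋₊ : ℕ) : ℝ) ≤ (n : ℕ) := by
      push_cast
      calc ∑ y ∈ s, (⌊π.1 y * (n : ℕ)⌋₊ : ℝ) ≤ ∑ y ∈ s, π.1 y * (n : ℕ) :=
            Finset.sum_le_sum fun y _ => Nat.floor_le (mul_nonneg (π.2.1 y) (hn n).le)
        _ = (∑ y ∈ s, π.1 y) * (n : ℕ) := (Finset.sum_mul ..).symm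
        _ ≤ 1 * (n : ℕ) := by
            refine mul_le_mul_of_nonneg_right ?_ (hn n).le
            rw [← π.2.2, hsum]
            exact le_add_of_nonneg_right (π.2.1 x₀)
        _ = (n : ℕ) := one_mul _
    exact_mod_cast h
  have hk₀ (n : ℕ+) : (k n x₀ : ℝ) / (n : ℕ) = 1 - ∑ y ∈ s, (⌊π.1 y * (n : ℕ)⌋₊ : ℝ) / (n : ℕ) := by
    simp only [k, if_true]
    rw [Nat.cast_sub (hle n), sub_div, div_self (hn n).ne', ← Finset.sum_div]
    push_cast
    rfl
  have hk (n : ℕ+) {x : X} (hx : x ≠ x₀) : k n x = ⌊π.1 x * (n : ℕ)⌋₊ := by simp [k, hx]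
  have hk₁ (n : ℕ+) : ∑ x, (k n x : ℝ) / (n : ℕ) = 1 := by
    rw [hsum, hk₀, Finset.sum_congr rfl fun y hy => by rw [hk n (Finset.ne_of_mem_erase hy)]]
    ring
  have hkle (n : ℕ+) (x : X) : k n x ≤ n := by
    have h := Finset.single_le_sum (f := fun x => (k n x : ℝ) / (n : ℕ))
      (fun y _ => div_nonneg (Nat.cast_nonneg _) (hn n).le) (Finset.mem_univ x)
    rw [hk₁, div_le_one (hn n)] at h
    exact_mod_cast h
  refine ⟨fun n => ⟨⟨fun x => (k n x : ℝ) / (n : ℕ),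
    fun x => div_nonneg (Nat.cast_nonneg _) (hn n).le, hk₁ n⟩, k n, hkle n, fun x => rfl⟩, ?_⟩
  have hfloor (x : X) :
      Tendsto (fun n : ℕ+ => (⌊π.1 x * (n : ℕ)⌋₊ : ℝ) / (n : ℕ)) atTop (𝓝 (π.1 x)) :=
    (tendsto_nat_floor_mul_div_atTop (π.2.1 x)).comp
      (tendsto_natCast_atTop_atTop.comp tendsto_PNat_val_atTop_atTop)
  rw [tendsto_subtype_rng, tendsto_pi_nhds]
  intro x
  by_cases hx : x = x₀
  · subst hx
    simp only [hk₀]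
    have h : π.1 x = 1 - ∑ y ∈ s, π.1 y := by
      have := hsum π.1
      rw [π.2.2] at this
      linarith
    rw [h]
    exact tendsto_const_nhds.sub (tendsto_finsetSum _ fun y _ => hfloor y)
  · simp only [hk _ hx]
    exact hfloor x

variable {d : Belief X → Belief X → ℝ} (hd : IsCompatibleMetric d)
  {ρ : (n : ℕ+) → Belief X → Grid X n} (hρ : ∀ n, IsNearestNeighbor d (ρ n))
include hd

lemma IsCompatibleMetric.ball_mem_nhds (π : Belief X) {r : ℝ} (hr : 0 < r) :
    {π' | d π π' < r} ∈ 𝓝 π :=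
  (hd.mem_nhds_iff π _).2 ⟨r, hr, fun _ h => h⟩

include hρ

/-- By compactness it is enough to approximate finitely many centres by grid points; every other
belief is close to a centre, and its nearest grid point is at least as close as the one
approximating that centre. -/
lemma eventually_dist_lt {r : ℝ} (hr : 0 < r) :
    ∀ᶠ n in atTop, ∀ π, d π (ρ n π).1 < r := by
  obtain ⟨t, ht⟩ := CompactSpace.elim_nhds_subcover
    (fun π : Belief X => {π' | d π π' < r / 2}) fun π => hd.ball_mem_nhds π (half_pos hr)
  choose z hz using exists_grid_tendsto (X := X)
  have h : ∀ᶠ n in atTop, ∀ b ∈ t, d b (z b n).1 < r / 2 :=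
    (Finset.eventually_all t).2 fun b _ => hz b (hd.ball_mem_nhds b (half_pos hr))
  filter_upwards [h] with n hn π
  have hπ : π ∈ ⋃ b ∈ t, {π' | d b π' < r / 2} := ht ▸ Set.mem_univ π
  simp only [Set.mem_iUnion] at hπ
  obtain ⟨b, hb, hbπ⟩ := hπ
  have h₁ : d b π < r / 2 := hbπ
  have h₂ := (hρ n).le_dist π (z b n)
  have h₃ := hd.triangle π b (z b n).1
  have h₄ := hn b hb
  rw [hd.symm π b] at h₃
  linarith

/-- The oscillation of a continuous function over the bins tends to zero. -/
lemma eventually_oscillation_le {g : Belief X → ℝ} (hg : Continuous g) {ε : ℝ} (hε : 0 < ε) :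
    ∀ᶠ n in atTop, ∀ π π', ρ n π = ρ n π' → |g π - g π'| ≤ ε := by
  have hloc (b : Belief X) : ∃ r > 0, ∀ π, d b π < r → |g π - g b| < ε / 4 :=
    (hd.mem_nhds_iff b {π | |g π - g b| < ε / 4}).1
      (hg.continuousAt (Metric.ball_mem_nhds (g b) (by positivity)))
  choose r hr hrg using hloc
  -- Half radii, so that a belief and its nearest grid point lie in a common ball of radius `r b`.
  -- Beliefs in one bin are then compared through their shared grid point.
  obtain ⟨t, ht⟩ := CompactSpace.elim_nhds_subcover
    (fun b : Belief X => {π | d b π < r b / 2}) fun b => hd.ball_mem_nhds b (half_pos (hr b))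
  have h : ∀ᶠ n in atTop, ∀ b ∈ t, ∀ π, d π (ρ n π).1 < r b / 2 :=
    (Finset.eventually_all t).2 fun b _ => eventually_dist_lt hd hρ (half_pos (hr b))
  filter_upwards [h] with n hn
  have key (π : Belief X) : |g π - g (ρ n π).1| ≤ ε / 2 := by
    have hπ : π ∈ ⋃ b ∈ t, {π' | d b π' < r b / 2} := ht ▸ Set.mem_univ π
    simp only [Set.mem_iUnion] at hπ
    obtain ⟨b, hb, hbπ⟩ := hπ
    have h₁ : d b π < r b / 2 := hbπ
    have h₂ := hd.triangle b π (ρ n π).1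
    have h₃ := hn b hb π
    have h₄ := hrg b π (by linarith [hr b])
    have h₅ := hrg b (ρ n π).1 (by linarith)
    rw [abs_lt] at h₄ h₅
    rw [abs_le]
    constructor <;> linarith
  intro π π' hππ'
  have h₁ := key π
  have h₂ := key π'
  rw [hππ'] at h₁
  rw [abs_le] at *
  constructor <;> linarith

end GridDensity

/-! ### Policy evaluation for finite Markov chains -/

section DiscountedChain

variable {ι : Type*} [Fintype ι] [DecidableEq ι] {P : Matrix ι ι ℝ}
  (hP₀ : ∀ i j, 0 ≤ P i j) (hP₁ : ∀ i, ∑ j, P i j = 1) {β : ℝ} (hβ₀ : 0 ≤ β) (hβ₁ : β < 1)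
include hP₀ hP₁

lemma abs_pow_mulVec_le {r : ι → ℝ} {R : ℝ} (hr : ∀ i, |r i| ≤ R) (k : ℕ) (i : ι) :
    |(P ^ k).mulVec r i| ≤ R := by
  induction k generalizing i with
  | zero => simpa using hr i
  | succ k ih =>
    rw [pow_succ', ← Matrix.mulVec_mulVec]
    simp only [Matrix.mulVec, dotProduct] at ih ⊢
    calc _ ≤ ∑ j, |P i j * _| := Finset.abs_sum_le_sum_abs _ _
      _ ≤ ∑ j, P i j * R := Finset.sum_le_sum fun j _ => by
          rw [abs_mul, abs_of_nonneg (hP₀ i j)]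
          exact mul_le_mul_of_nonneg_left (ih j) (hP₀ i j)
      _ = R := by rw [← Finset.sum_mul, hP₁, one_mul]

include hβ₀ hβ₁

/-- The discounted cost of a finite Markov chain solves the policy evaluation equation. -/
lemma discountedChain_eq (r : ι → ℝ) (i : ι) :
    ∑' k, β ^ k * (P ^ k).mulVec r i =
      r i + β * ∑ j, P i j * ∑' k, β ^ k * (P ^ k).mulVec r j := by
  obtain ⟨R, hR⟩ := (Set.finite_range fun i => |r i|).bddAbove
  have hr (i : ι) : |r i| ≤ R := hR ⟨i, rfl⟩
  have hs (i : ι) : Summable fun k => β ^ k * (P ^ k).mulVec r i :=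
    summable_discounted hβ₀ hβ₁ fun k => abs_pow_mulVec_le hP₀ hP₁ hr k i
  rw [(hs i).tsum_eq_zero_add]
  simp only [pow_zero, one_mul, Matrix.one_mulVec]
  congr 1
  simp_rw [← tsum_mul_left]
  rw [← Summable.tsum_finsetSum fun j _ => (hs j).mul_left _, ← tsum_mul_left]
  refine tsum_congr fun k => ?_
  rw [pow_succ' P, ← Matrix.mulVec_mulVec]
  conv_lhs => rw [Matrix.mulVec, dotProduct]
  rw [Finset.mul_sum, Finset.mul_sum]
  refine Finset.sum_congr rfl fun j _ => ?_
  rw [pow_succ]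
  ring

/-- A supersolution of the policy evaluation equation dominates its solution. -/
lemma le_of_supersolution {r J V : ι → ℝ} (hJ : ∀ i, J i = r i + β * ∑ j, P i j * J j)
    (hV : ∀ i, r i + β * ∑ j, P i j * V j ≤ V i) (i : ι) : J i ≤ V i := by
  have : Nonempty ι := ⟨i⟩
  -- Minimum principle: at a minimizer of `V - J` the minimum is at least `β` times itself, hence
  -- nonnegative.
  obtain ⟨m, hm⟩ := Finite.exists_min fun i => V i - J i
  have h : V m - J m ≤ ∑ j, P m j * (V j - J j) := by
    calc V m - J m = ∑ j, P m j * (V m - J m) := by rw [← Finset.sum_mul, hP₁, one_mul]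
      _ ≤ _ := Finset.sum_le_sum fun j _ => mul_le_mul_of_nonneg_left (hm j) (hP₀ m j)
  have h' := mul_le_mul_of_nonneg_left h hβ₀
  simp only [mul_sub, Finset.sum_sub_distrib] at h'
  have h₀ : 0 ≤ (1 - β) * (V m - J m) := by linarith [hJ m, hV m]
  have h₁ := nonneg_of_mul_nonneg_right h₀ (by linarith)
  linarith [hm i]

end DiscountedChain

/-! ### The grid MDP as a bin average of the predictor MDP -/

section GridMDP

variable {X U M W : Type*} [MeasurableSpace W] [Fintype X] [Fintype M]

lemma measurable_cellMass (Q : X → M) (q : M) :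
    Measurable fun π : Belief X => cellMass π Q q := by
  unfold cellMass
  exact Finset.measurable_fun_sum _ fun x _ =>
    (measurable_pi_apply x).comp measurable_subtype_coe

lemma measurable_update (S : Source X U W) (a : Action X M U) (q : M) :
    Measurable fun π : Belief X => update S π a q := by
  classical
  have hx (x : X) : Measurable fun π : Belief X => π.1 x :=
    (measurable_pi_apply x).comp measurable_subtype_coe
  have h : Measurable fun π : Belief X => (update S π a q).1 := by
    refine measurable_pi_iff.2 fun x' => ?_
    have h' : (fun π : Belief X => (update S π a q).1 x') = fun π =>
        if cellMass π a.1 q = 0 then π.1 x' else (cellMass π a.1 q)⁻¹ *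
          ∑ x with a.1 x = q, transProb S x (a.2 (a.1, q)) x' * π.1 x := by
      funext π
      simp only [update]
      split_ifs <;> rfl
    rw [h']
    refine Measurable.ite (measurable_cellMass a.1 q (measurableSet_singleton 0)) (hx x') ?_
    exact (measurable_cellMass a.1 q).inv.mul
      (Finset.measurable_fun_sum _ fun x _ => (hx x).const_mul _)
  exact Measurable.subtype_mk (h := fun π => (update S π a q).2) h

open Classical in
lemma predictorKernel_real (S : Source X U W) (π : Belief X) (a : Action X M U)
    {A : Set (Belief X)} (hA : MeasurableSet A) :
    (predictorKernel S π a).real A =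
      ∑ q, cellMass π a.1 q * if update S π a q ∈ A then 1 else 0 := by
  rw [measureReal_def, predictorKernel, Measure.finsetSum_apply, ENNReal.toReal_sum]
  · refine Finset.sum_congr rfl fun q _ => ?_
    rw [Measure.smul_apply, smul_eq_mul, ENNReal.toReal_mul,
      ENNReal.toReal_ofReal (cellMass_nonneg π a.1 q), Measure.dirac_apply' _ hA,
      Set.indicator_apply]
    split_ifs <;> simp
  · intro q _
    rw [Measure.smul_apply, smul_eq_mul]
    exact ENNReal.mul_ne_top ENNReal.ofReal_ne_top (measure_ne_top _ _)

lemma measurable_predictorKernel_real (S : Source X U W) (a : Action X M U)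
    {A : Set (Belief X)} (hA : MeasurableSet A) :
    Measurable fun π => (predictorKernel S π a).real A := by
  classical
  simp only [predictorKernel_real S _ a hA]
  exact Finset.measurable_fun_sum _ fun q _ => (measurable_cellMass a.1 q).mul
    (Measurable.ite (measurable_update S a q hA) measurable_const measurable_const)

lemma predictorKernel_real_le_one (S : Source X U W) (π : Belief X) (a : Action X M U)
    {A : Set (Belief X)} (hA : MeasurableSet A) : (predictorKernel S π a).real A ≤ 1 := by
  classical
  rw [predictorKernel_real S π a hA]
  refine le_trans ?_ (sum_cellMass π a.1).le
  refine Finset.sum_le_sum fun q _ => mul_le_of_le_one_right (cellMass_nonneg π a.1 q) ?_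
  split_ifs <;> norm_num

lemma continuous_predictorStageCost (c : X → U → ℝ) (a : Action X M U) :
    Continuous fun π : Belief X => predictorStageCost c π a := by
  unfold predictorStageCost
  exact continuous_finsetSum _ fun x _ =>
    ((continuous_apply x).comp continuous_subtype_val).mul continuous_const

variable {n : ℕ+} {ρ : Belief X → Grid X n} (hρ : Measurable ρ)

include hρ

lemma measurableSet_bin (z : Grid X n) : MeasurableSet (bin ρ z) :=
  hρ (measurableSet_singleton z)

lemma sum_predictorKernel_bin_mul (S : Source X U W) (π : Belief X) (a : Action X M U)
    (J : Grid X n → ℝ) :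
    ∑ z, (predictorKernel S π a).real (bin ρ z) * J z =
      ∑ q, cellMass π a.1 q * J (ρ (update S π a q)) := by
  classical
  simp only [predictorKernel_real S π a (measurableSet_bin hρ _), Finset.sum_mul]
  rw [Finset.sum_comm]
  refine Finset.sum_congr rfl fun q _ => ?_
  rw [Finset.sum_eq_single (ρ (update S π a q))]
  · rw [if_pos (show update S π a q ∈ bin ρ (ρ (update S π a q)) from rfl), mul_one]
  · intro z _ hz
    rw [if_neg fun h : update S π a q ∈ bin ρ z => hz (Eq.symm h), mul_zero, zero_mul]
  · exact fun h => absurd (Finset.mem_univ _) h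

variable {κ : Measure (Belief X)} [IsFiniteMeasure κ]

lemma integrable_predictorKernel_real (S : Source X U W) (a : Action X M U) (s : Set (Belief X))
    (z : Grid X n) :
    Integrable (fun π => (predictorKernel S π a).real (bin ρ z)) (κ.restrict s) :=
  Integrable.of_bound
    (measurable_predictorKernel_real S a (measurableSet_bin hρ z)).aestronglyMeasurable 1
    (ae_of_all _ fun π => by
      rw [Real.norm_of_nonneg measureReal_nonneg]
      exact predictorKernel_real_le_one S π a (measurableSet_bin hρ z))

omit hρ in
lemma integrable_predictorStageCost (c : X → U → ℝ) (a : Action X M U) (s : Set (Belief X)) :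
    Integrable (fun π => predictorStageCost c π a) (κ.restrict s) := by
  obtain ⟨C, hC⟩ := isCompact_univ.exists_bound_of_continuousOn
    (continuous_predictorStageCost c a).continuousOn
  exact Integrable.of_bound (continuous_predictorStageCost c a).measurable.aestronglyMeasurable C
    (ae_of_all _ fun π => hC π (Set.mem_univ π))

lemma integrable_sum_predictorKernel (S : Source X U W) (a : Action X M U) (s : Set (Belief X))
    (J : Grid X n → ℝ) :
    Integrable (fun π => ∑ z, (predictorKernel S π a).real (bin ρ z) * J z) (κ.restrict s) :=
  integrable_finsetSum _ fun z _ => (integrable_predictorKernel_real hρ S a s z).mul_const _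

lemma integrable_predictorBackup (S : Source X U W) (c : X → U → ℝ) (β : ℝ) (J : Grid X n → ℝ)
    (a : Action X M U) (s : Set (Belief X)) :
    Integrable (fun π => predictorBackup S c β (fun π => J (ρ π)) π a) (κ.restrict s) := by
  simp only [predictorBackup, ← sum_predictorKernel_bin_mul hρ S _ a J]
  exact (integrable_predictorStageCost c a s).add
    ((integrable_sum_predictorKernel hρ S a s J).const_mul β)

/-- The dynamic programming operator of the grid MDP averages the one of the predictor MDP. -/
lemma gridBackup_eq (S : Source X U W) (c : X → U → ℝ) (β : ℝ) (J : Grid X n → ℝ) (z : Grid X n)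
    (a : Action X M U) :
    gridStageCost c κ ρ z a + β * ∑ z', gridTrans S κ ρ z a z' * J z' =
      (κ.real (bin ρ z))⁻¹ *
        ∫ π in bin ρ z, predictorBackup S c β (fun π => J (ρ π)) π a ∂κ := by
  simp only [predictorBackup, ← sum_predictorKernel_bin_mul hρ S _ a J]
  rw [integral_add (integrable_predictorStageCost c a _)
      ((integrable_sum_predictorKernel hρ S a _ J).const_mul β), integral_const_mul,
    integral_finsetSum _ fun z' _ => (integrable_predictorKernel_real hρ S a _ z').mul_const _]
  simp only [integral_mul_const, gridStageCost, gridTrans, mul_add, Finset.mul_sum]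
  congr 1
  exact Finset.sum_congr rfl fun z' _ => by ring

omit hρ in
lemma gridTrans_nonneg (S : Source X U W) (z : Grid X n) (a : Action X M U) (z' : Grid X n) :
    0 ≤ gridTrans S κ ρ z a z' :=
  mul_nonneg (inv_nonneg.2 measureReal_nonneg)
    (integral_nonneg fun _ => measureReal_nonneg)

variable (hκ : ∀ z, 0 < κ (bin ρ z))
include hκ

lemma bin_real_pos (z : Grid X n) : 0 < κ.real (bin ρ z) :=
  ENNReal.toReal_pos (hκ z).ne' (measure_ne_top _ _)

lemma sum_gridTrans (S : Source X U W) (z : Grid X n) (a : Action X M U) :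
    ∑ z', gridTrans S κ ρ z a z' = 1 := by
  -- With zero cost, unit discount and unit value, the averaging identity reduces to conservation of
  -- mass.
  have h := gridBackup_eq hρ (κ := κ) S (fun _ _ => 0) 1 (fun _ => 1) z a
  have h₁ (π : Belief X) :
      predictorBackup S (fun _ _ => 0) 1 (fun _ : Belief X => 1) π a = 1 := by
    simp [predictorBackup, predictorStageCost, sum_cellMass]
  simp only [h₁, gridStageCost, predictorStageCost] at h
  have h₂ := bin_real_pos hρ hκ z
  simpa [h₂.ne'] using h

lemma average_le {g : Belief X → ℝ} {z : Grid X n} {b : ℝ}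
    (hg : Integrable g (κ.restrict (bin ρ z))) (h : ∀ π, ρ π = z → g π ≤ b) :
    (κ.real (bin ρ z))⁻¹ * ∫ π in bin ρ z, g π ∂κ ≤ b := by
  have h₁ := bin_real_pos hρ hκ z
  have h₂ := setIntegral_mono_on hg (integrable_const b) (measurableSet_bin hρ z) h
  rw [setIntegral_const, smul_eq_mul] at h₂
  rwa [inv_mul_le_iff₀ h₁]

lemma le_average {g : Belief X → ℝ} {z : Grid X n} {b : ℝ}
    (hg : Integrable g (κ.restrict (bin ρ z))) (h : ∀ π, ρ π = z → b ≤ g π) :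
    b ≤ (κ.real (bin ρ z))⁻¹ * ∫ π in bin ρ z, g π ∂κ := by
  have h₁ := bin_real_pos hρ hκ z
  have h₂ := setIntegral_mono_on (integrable_const b) hg (measurableSet_bin hρ z) h
  rw [setIntegral_const, smul_eq_mul] at h₂
  rwa [le_inv_mul_iff₀ h₁]

variable {β : ℝ} (hβ₀ : 0 ≤ β) (hβ₁ : β < 1)
include hβ₀ hβ₁

lemma gridCost_eq (S : Source X U W) (c : X → U → ℝ) (γ : Grid X n → Action X M U)
    (z : Grid X n) :
    gridCost S c β κ ρ γ z = gridStageCost c κ ρ z (γ z) +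
      β * ∑ z', gridTrans S κ ρ z (γ z) z' * gridCost S c β κ ρ γ z' :=
  discountedChain_eq (P := Matrix.of fun z₁ z₂ => gridTrans S κ ρ z₁ (γ z₁) z₂)
    (fun z z' => gridTrans_nonneg S z (γ z) z') (fun z => sum_gridTrans hρ hκ S z (γ z))
    hβ₀ hβ₁ (fun z₁ => gridStageCost c κ ρ z₁ (γ z₁)) z

/-- The cost of an optimal policy satisfies the Bellman inequality. -/
lemma gridCost_le_of_isOptimal {S : Source X U W} {c : X → U → ℝ} {γ : Grid X n → Action X M U}
    (hγ : IsOptimalGridPolicy S c β κ ρ γ) (z : Grid X n) (a : Action X M U) :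
    gridCost S c β κ ρ γ z ≤ gridStageCost c κ ρ z a +
      β * ∑ z', gridTrans S κ ρ z a z' * gridCost S c β κ ρ γ z' := by
  by_contra! hlt
  -- Deviating to `a` at the single state `z`: if the inequality failed, the cost of `γ` would be a
  -- supersolution for `γ'`, and `γ'` would be strictly cheaper at `z`.
  let γ' := Function.update γ z a
  have hz : γ' z = a := Function.update_self ..
  have hle := le_of_supersolution (P := Matrix.of fun z₁ z₂ => gridTrans S κ ρ z₁ (γ' z₁) z₂)
    (fun z z' => gridTrans_nonneg S z (γ' z) z') (fun z => sum_gridTrans hρ hκ S z (γ' z))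
    hβ₀ hβ₁ (r := fun z₁ => gridStageCost c κ ρ z₁ (γ' z₁))
    (gridCost_eq hρ hκ hβ₀ hβ₁ S c γ') (V := gridCost S c β κ ρ γ) (by
      intro y
      by_cases hy : y = z
      · subst hy
        simp only [Matrix.of_apply, hz]
        exact hlt.le
      · have hy' : γ' y = γ y := Function.update_of_ne hy ..
        simp only [Matrix.of_apply, hy']
        exact (gridCost_eq hρ hκ hβ₀ hβ₁ S c γ y).ge)
  have h₁ := gridCost_eq hρ hκ hβ₀ hβ₁ S c γ' z
  rw [hz] at h₁
  have h₂ : ∑ z', gridTrans S κ ρ z a z' * gridCost S c β κ ρ γ' z' ≤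
      ∑ z', gridTrans S κ ρ z a z' * gridCost S c β κ ρ γ z' :=
    Finset.sum_le_sum fun z' _ => mul_le_mul_of_nonneg_left (hle z') (gridTrans_nonneg S z a z')
  have h₃ := mul_le_mul_of_nonneg_left h₂ hβ₀
  have h₄ := hγ γ' z
  linarith

/-- If `v` almost solves the Bellman equation of the predictor MDP and its backups are almost
constant on the bins, an optimal grid policy is almost greedy with respect to `v`. -/
lemma predictorBackup_le_of_isOptimal {S : Source X U W} {c : X → U → ℝ}
    {γ : Grid X n → Action X M U} (hγ : IsOptimalGridPolicy S c β κ ρ γ) {v : Belief X → ℝ}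
    {B δ ε : ℝ} (hB : ∀ π, |v π| ≤ B)
    (hlow : ∀ π (a : Action X M U), v π - δ ≤ predictorBackup S c β v π a)
    (hupp : ∀ π, ∃ a : Action X M U, predictorBackup S c β v π a ≤ v π + δ)
    (hosc : ∀ (a : Action X M U) π π', ρ π = ρ π' →
      |predictorBackup S c β v π a - predictorBackup S c β v π' a| ≤ ε) (π : Belief X) :
    predictorBackup S c β v π (extendPolicy ρ γ π) ≤
      v π + (ε + (1 + β) * ((δ + ε) / (1 - β))) := by
  set J := gridCost S c β κ ρ γ with hJ
  -- Replacing `J` by `v` inside a backup costs `β * D`, moving within a bin costs `ε`, and the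
  -- defect of the Bellman equation costs `δ`.
  have hle {D : ℝ} (hD : ∀ π, |J (ρ π) - v π| ≤ D) (π : Belief X) :
      J (ρ π) ≤ v π + (β * D + (δ + ε)) := by
    obtain ⟨a, ha⟩ := hupp π
    refine (gridCost_le_of_isOptimal hρ hκ hβ₀ hβ₁ hγ (ρ π) a).trans ?_
    rw [gridBackup_eq hρ]
    refine average_le hρ hκ (integrable_predictorBackup hρ S c β J a _) fun π' hπ' => ?_
    have h₁ := predictorBackup_mono S c hβ₀ (g := fun π => J (ρ π)) (g' := v) (D := D)
      (fun π => by linarith [(abs_le.1 (hD π)).2]) π' a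
    linarith [(abs_le.1 (hosc a π' π hπ')).2]
  have hge {D : ℝ} (hD : ∀ π, |J (ρ π) - v π| ≤ D) (π : Belief X) :
      predictorBackup S c β v π (γ (ρ π)) - (β * D + ε) ≤ J (ρ π) := by
    rw [hJ, gridCost_eq hρ hκ hβ₀ hβ₁, gridBackup_eq hρ]
    refine le_average hρ hκ (integrable_predictorBackup hρ S c β J _ _) fun π' hπ' => ?_
    have h₁ := predictorBackup_mono S c hβ₀ (g := v) (g' := fun π => J (ρ π)) (D := D)
      (fun π => by linarith [(abs_le.1 (hD π)).1]) π' (γ (ρ π))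
    linarith [(abs_le.1 (hosc (γ (ρ π)) π' π hπ')).1]
  have : Nonempty (Belief X) := ⟨π⟩
  have hbdd : BddAbove (Set.range fun π => |J (ρ π) - v π|) := by
    obtain ⟨R, hR⟩ := (Set.finite_range fun z => |J z|).bddAbove
    refine ⟨R + B, ?_⟩
    rintro _ ⟨π, rfl⟩
    exact (abs_sub _ _).trans (add_le_add (hR ⟨ρ π, rfl⟩) (hB π))
  set D := ⨆ π, |J (ρ π) - v π| with hDdef
  have hD (π : Belief X) : |J (ρ π) - v π| ≤ D := le_ciSup hbdd π
  have hDle : D ≤ (δ + ε) / (1 - β) := by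
    -- The error bound reproduces itself with factor `β`; solving for `D` needs its finiteness,
    -- supplied by `hbdd`.
    have h : D ≤ β * D + (δ + ε) := ciSup_le fun π => by
      rw [abs_le]
      constructor <;> linarith [hle hD π, hge hD π, hlow π (γ (ρ π))]
    rw [le_div_iff₀ (by linarith)]
    linarith
  -- The backup exceeds `J` by at most `β * D + ε`, and `J` exceeds `v` by at most `D`, whence the
  -- factor `1 + β`.
  have h₁ := hge hD π
  have h₂ := (abs_le.1 (hD π)).2
  have h₃ := mul_le_mul_of_nonneg_left hDle (show 0 ≤ 1 + β by linarith)
  simp only [extendPolicy]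
  linarith

end GridMDP

/-! ### Choice of horizon and grid, and the limit -/

section Convergence

variable {X U M W : Type*} [MeasurableSpace W] [Fintype X] [Fintype U] [Nonempty U]
  [Fintype M] [Nonempty M] (S : Source X U W) (c : X → U → ℝ) {β : ℝ} (hβ₀ : 0 ≤ β) (hβ₁ : β < 1)
include hβ₀ hβ₁

lemma horizonValue_sub_le_optimalCost {C : ℝ} (hC : ∀ x u, |c x u| ≤ C) (N : ℕ) (π₀ : Belief X) :
    horizonValue M S c β N π₀.1 - β ^ N * C / (1 - β) ≤ optimalCost M S c β π₀ := by
  have : Nonempty (AdmissiblePolicy X U M) :=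
    ⟨⟨fun _ _ _ => Classical.arbitrary M, fun _ _ _ => Classical.arbitrary U⟩⟩
  exact le_ciInf fun γ => horizonValue_sub_le_systemCost S γ π₀ c hβ₀ hβ₁ hC N

lemma optimalCost_le_systemCost {C : ℝ} (hC : ∀ x u, |c x u| ≤ C) (π₀ : Belief X)
    (γ : AdmissiblePolicy X U M) : optimalCost M S c β π₀ ≤ systemCost S c β π₀ γ := by
  -- The horizon-zero estimate is enough to bound the infimum below.
  refine ciInf_le ⟨horizonValue M S c β 0 π₀.1 - β ^ 0 * C / (1 - β), ?_⟩ γ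
  rintro _ ⟨γ, rfl⟩
  exact horizonValue_sub_le_systemCost S γ π₀ c hβ₀ hβ₁ hC 0

omit hβ₁ in
lemma abs_horizonValue_succ_sub_le_belief {C : ℝ} (hC : ∀ x u, |c x u| ≤ C) (N : ℕ)
    (π : Belief X) :
    |horizonValue M S c β (N + 1) π.1 - horizonValue M S c β N π.1| ≤ β ^ N * C := by
  simpa [π.2.2] using abs_horizonValue_succ_sub_le (M := M) S c hβ₀ hC N π.2.1

variable {d : Belief X → Belief X → ℝ} (hd : IsCompatibleMetric d)
  {ρ : (n : ℕ+) → Belief X → Grid X n} (hρ : ∀ n, IsNearestNeighbor d (ρ n))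
  {κ : ℕ+ → Measure (Belief X)} (hκ : ∀ n, IsProbabilityMeasure (κ n))
  (hκ_pos : ∀ (n : ℕ+) (z : Grid X n), 0 < κ n (bin (ρ n) z))
  {γ : (n : ℕ+) → Grid X n → Action X M U}
  (hγ : ∀ n, IsOptimalGridPolicy S c β (κ n) (ρ n) (γ n))
include hd hρ hκ hκ_pos hγ

/-- The Bellman defect, at most `β ^ N * C`, and the bin oscillation are both bounded by the same
`s`. -/
lemma eventually_systemCost_le {C : ℝ} (hC : ∀ x u, |c x u| ≤ C) (N : ℕ) {s : ℝ} (hs : 0 < s)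
    (hN : β ^ N * C ≤ s) (π₀ : Belief X) :
    ∀ᶠ n in atTop, systemCost S c β π₀ (inducedPolicy S (extendPolicy (ρ n) (γ n)) π₀) ≤
      horizonValue M S c β N π₀.1 + (s + (1 + β) * ((s + s) / (1 - β))) / (1 - β) := by
  obtain ⟨B, hB⟩ := isCompact_univ.exists_bound_of_continuousOn
    ((continuous_horizonValue (M := M) S c (β := β) N).comp
      (continuous_subtype_val (p := (· ∈ stdSimplex ℝ X)))).continuousOn
  have hosc : ∀ᶠ n in atTop, ∀ (a : Action X M U) π π', ρ n π = ρ n π' →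
      |predictorBackup S c β (fun π => horizonValue M S c β N π.1) π a -
        predictorBackup S c β (fun π => horizonValue M S c β N π.1) π' a| ≤ s :=
    eventually_all.2 fun a =>
      eventually_oscillation_le hd hρ (continuous_predictorBackup S c β N a) hs
  filter_upwards [hosc] with n hn
  have := hκ n
  refine systemCost_inducedPolicy_le S _ π₀ c hβ₀ hβ₁ hC
    (g := fun π => horizonValue M S c β N π.1) (fun π => hB π (Set.mem_univ π)) ?_
  refine predictorBackup_le_of_isOptimal (hρ n).measurable (hκ_pos n) hβ₀ hβ₁ (hγ n)
    (fun π => hB π (Set.mem_univ π)) ?_ ?_ hn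
  · intro π a
    have h₁ := abs_le.1 (abs_horizonValue_succ_sub_le_belief (M := M) S c hβ₀ hC N π)
    have h₂ := horizonValue_succ_le S c (β := β) N π.1 a.1 fun q => a.2 (a.1, q)
    rw [jointValue_splitBy] at h₂
    linarith [h₁.1]
  · intro π
    obtain ⟨Q, u, h⟩ := exists_horizonValue_succ_eq (M := M) S c (β := β) N π.1
    -- A control rule may ignore its quantizer argument, so every `u : M → U` is realized by an
    -- action.
    refine ⟨(Q, fun p => u p.2), ?_⟩
    have h₁ := abs_le.1 (abs_horizonValue_succ_sub_le_belief (M := M) S c hβ₀ hC N π)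
    have h₂ := jointValue_splitBy S c β N π (Q, fun p => u p.2)
    dsimp only at h₂
    rw [← h₂, h]
    linarith [h₁.2]

lemma tendsto_systemCost_sub_optimalCost (π₀ : Belief X) :
    Tendsto (fun n => |systemCost S c β π₀ (inducedPolicy S (extendPolicy (ρ n) (γ n)) π₀) -
      optimalCost M S c β π₀|) atTop (𝓝 0) := by
  obtain ⟨C, hC⟩ := (Set.finite_range fun p : X × U => |c p.1 p.2|).bddAbove
  replace hC (x : X) (u : U) : |c x u| ≤ C := hC ⟨(x, u), rfl⟩
  have hβ : 0 < 1 - β := by linarith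
  -- `s * L` is the upper error of the extended policy plus the tail in the lower bound; the choice
  -- of `s` makes it `η / 2`.
  set L : ℝ := (1 + (1 + β) * (2 / (1 - β))) / (1 - β) + 1 / (1 - β) with hL
  have hLpos : 0 < L := by positivity
  rw [Metric.tendsto_nhds]
  intro η hη
  set s : ℝ := η / (2 * L) with hs
  have hspos : 0 < s := by positivity
  obtain ⟨N, hN⟩ : ∃ N : ℕ, β ^ N * C ≤ s := by
    have h := (tendsto_pow_atTop_nhds_zero_of_lt_one hβ₀ hβ₁).mul_const C
    rw [zero_mul] at h
    exact (h.eventually (ge_mem_nhds hspos)).exists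
  filter_upwards [eventually_systemCost_le S c hβ₀ hβ₁ hd hρ hκ hκ_pos hγ hC N hspos hN π₀]
    with n hn
  have h₁ := horizonValue_sub_le_optimalCost (M := M) S c hβ₀ hβ₁ hC N π₀
  have h₂ := optimalCost_le_systemCost S c hβ₀ hβ₁ hC π₀
    (inducedPolicy S (extendPolicy (ρ n) (γ n)) π₀)
  have h₃ : β ^ N * C / (1 - β) ≤ s / (1 - β) := div_le_div_of_nonneg_right hN hβ.le
  have h₄ : (s + (1 + β) * ((s + s) / (1 - β))) / (1 - β) + s / (1 - β) = s * L := by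
    rw [hL]
    ring
  have h₅ : s * L = η / 2 := by
    rw [hs]
    field_simp
  rw [Real.dist_eq, sub_zero, abs_abs, abs_of_nonneg (by linarith)]
  linarith

end Convergence

end PredictorQuantization

end

open PredictorQuantization in
theorem mainTheorem3 {X U M W : Type*} [Fintype X] [Finite U] [Nonempty U]
    [Fintype M] [Nonempty M] [MeasurableSpace W]
    (S : Source X U W) (c : X → U → ℝ) (β : ℝ) (hβ₀ : 0 < β) (hβ₁ : β < 1)
    (d : Belief X → Belief X → ℝ) (hd : IsCompatibleMetric d)
    (ρ : (n : ℕ+) → Belief X → Grid X n) (hρ : ∀ n, IsNearestNeighbor d (ρ n))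
    (κ : ℕ+ → MeasureTheory.Measure (Belief X))
    (hκ : ∀ n, MeasureTheory.IsProbabilityMeasure (κ n))
    (hκ_pos : ∀ (n : ℕ+) (z : Grid X n), 0 < κ n (bin (ρ n) z))
    (γ : (n : ℕ+) → Grid X n → Action X M U)
    (hγ : ∀ n, IsOptimalGridPolicy S c β (κ n) (ρ n) (γ n)) (π₀ : Belief X) :
    Filter.Tendsto
        (fun n => |predictorCost S c β π₀ (extendPolicy (ρ n) (γ n)) - optimalCost M S c β π₀|)
        Filter.atTop (nhds 0) ∧
      Filter.Tendsto
        (fun n => |systemCost S c β π₀ (inducedPolicy S (extendPolicy (ρ n) (γ n)) π₀) -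
          optimalCost M S c β π₀|)
        Filter.atTop (nhds 0) := by
  have := Fintype.ofFinite U
  have h := tendsto_systemCost_sub_optimalCost S c hβ₀.le hβ₁ hd hρ hκ hκ_pos hγ π₀
  refine ⟨?_, h⟩
  simpa only [predictorCost_eq_systemCost] using h
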